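/- Notation. For $n\ge 1$, $d\ge 1$ and $z\in\mathbb R^n$ let $m_d(z)=(z^\alpha)_{|\alpha|\le d}\in\mathbb R^{N}$, $N=\binom{n+d}{d}$, be the vector of all monomials of degree at most $d$; equivalently, $m_d(z)=(u^\alpha)_{\alpha\in\mathbb N^{n+1},|\alpha|=d}$ with $u=[1;z]$. Let $\mathcal C_{n+1,2d}$ be the pseudo-moment cone: the set of matrices $M(\ell)=(\ell(x^{\alpha+\beta}))_{|\alpha|=|\beta|=d}$, where $\ell$ runs over the linear functionals on real forms of degree $2d$ in $n+1$ variables with $\ell(q^2)\ge 0$ for every form $q$ of degree $d$ (equivalently, the positive semidefinite $N\times N$ matrices whose $(\alpha,\beta)$ entry depends only on $\alpha+\beta$). For a convex set $C$ and $x\in C$, $\mathrm{minface}(x,C)$ is the smallest face of $C$ containing $x$. A property holds for generically chosen points of a finite-dimensional real vector space if it holds on a Zariski-open dense subset. Algorithm (extreme ray decomposition). Input: a cone $C$ of symmetric $N\times N$ matrices and $X\in C$, $X\neq 0$. Put $X_1=X$. For $k=1,2,\dots$, while $X_k\ne 0$: let $F_k=\mathrm{minface}(X_k,C)$; draw a random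 symmetric matrix $B_k$ whose distribution is absolutely continuous with respect to Lebesgue measure on the space of symmetric matrices; choose any $M_k\in\arg\min\{\mathrm{tr}(B_kY): Y\in F_k,\ \mathrm{tr}\,Y=1\}$; let $t_k=\sup\{t\ge 0: X_k-tM_k\in F_k\}$; put $X_{k+1}=X_k-t_kM_k$. When $X_k=0$, return $r=k-1$ and $\{t_k,M_k\}_{k=1}^r$. All steps are carried out in exact arithmetic. Theorem. Fix $d\ge 2$, and for $n \ge 1$ put $$b(n,d)=\frac12\left(\binom{n+d}{d}+1\right)-\binom{n+d}{d}^{-1}\binom{n+2d}{2d},$$ which grows as $\Theta(n^d)$ as $n\to\infty$. Let $n\ge 1$ and let $s\geq 1$ be an integer with $s\le b(n,d)$. Then for generically chosen $(w_i,z_i)_{i=1}^s\in(\mathbb R\times\mathbb R^n)^s$ the following holds. Let $X=\sum_{i=1}^s w_i^2\,m_d(z_i)m_d(z_i)^{\mathsf T}$. For every choice of absolutely continuous distributions of the matrices $B_k$ (the joint distribution being arbitrary), almost surely every execution of the algorithm on $(\mathcal C_{n+1,2d},X)$ is well defined, terminates, and returns $\{t_k,M_k\}_{k=1}^r$ such that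 $r=s$ and, for some bijection $\sigma$ of $\{1,\dots,s\}$, $$t_k=w_{\sigma(k)}^2\,\|m_d(z_{\sigma(k)})\|_2^2,\qquad M_k=\frac{m_d(z_{\sigma(k)})\,m_d(z_{\sigma(k)})^{\mathsf T}}{\|m_d(z_{\sigma(k)})\|_2^2}\qquad (1\le k\le s).$$ -/

import Mathlib

open Filter Asymptotics MeasureTheory MvPolynomial

noncomputable section

namespace PseudoMoment

/-! ### Genericity in a finite-dimensional real vector space -/

section Generic

variable {V : Type*} [AddCommGroup V] [Module ℝ V]

/-- Real polynomial functions on `V`: the algebra of functions generated by the linear forms. -/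
def polyFun (V : Type*) [AddCommGroup V] [Module ℝ V] : Subalgebra ℝ (V → ℝ) :=
  Algebra.adjoin ℝ (Set.range fun φ : Module.Dual ℝ V => (φ : V → ℝ))

/-- A variety: the common zero set of finitely many real polynomial functions. -/
def IsVariety (S : Set V) : Prop :=
  ∃ F : Set (V → ℝ), F.Finite ∧ F ⊆ (polyFun V : Set (V → ℝ)) ∧ S = {v | ∀ f ∈ F, f v = 0}

/-- Zariski-open sets are the complements of varieties. -/
def IsZariskiOpen (U : Set V) : Prop := IsVariety Uᶜ

/-- Zariski-dense: the only variety containing `U` is the whole space. -/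
def IsZariskiDense (U : Set V) : Prop := ∀ S : Set V, IsVariety S → U ⊆ S → S = Set.univ

/-- `P` holds for generically chosen points of `V`: it holds on a Zariski-open dense subset. -/
def HoldsGenerically (P : V → Prop) : Prop :=
  ∃ U : Set V, IsZariskiOpen U ∧ IsZariskiDense U ∧ ∀ v ∈ U, P v

end Generic

/-! ### Monomials and the pseudo-moment cone -/

/-- Multi-indices `α ∈ ℕ^m` with `|α| = d`. -/
abbrev MultiIndex (m d : ℕ) : Type := {α : Fin m →₀ ℕ // α.degree = d}

instance (m d : ℕ) : Fintype (MultiIndex m d) :=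
  Fintype.subtype (Finset.finsuppAntidiag Finset.univ d) (by
    intro α
    simp [Finset.mem_finsuppAntidiag, Finsupp.degree_eq_sum])

/-- Real square matrices indexed by the monomials of degree `d` in `m` variables. -/
abbrev MomMat (m d : ℕ) : Type := Matrix (MultiIndex m d) (MultiIndex m d) ℝ

/-- The vector `v_d(u)` of all monomials of degree `d` evaluated at `u ∈ ℝ^m`. -/
def homMomentVec {m : ℕ} (d : ℕ) (u : Fin m → ℝ) : MultiIndex m d → ℝ :=
  fun α => ∏ i, u i ^ α.1 i

/-- The vector `m_d(z) = v_d([1; z])` of all monomials of degree at most `d` in `z ∈ ℝ^n`.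
A monomial `z^α` with `|α| ≤ d` is indexed by the exponent `(d - |α|, α) ∈ ℕ^(n+1)`. -/
def momentVec {n : ℕ} (d : ℕ) (z : Fin n → ℝ) : MultiIndex (n + 1) d → ℝ :=
  homMomentVec d (Fin.cons 1 z : Fin (n + 1) → ℝ)

/-- The moment atom `m_d(z) m_d(z)ᵀ`. -/
def momentAtom {n : ℕ} (d : ℕ) (z : Fin n → ℝ) : MomMat (n + 1) d :=
  Matrix.vecMulVec (momentVec d z) (momentVec d z)

/-- The square of the Euclidean norm of `m_d(z)`. -/
def momentNormSq {n : ℕ} (d : ℕ) (z : Fin n → ℝ) : ℝ :=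
  ‖WithLp.toLp 2 (momentVec d z)‖ ^ 2

/-- Real forms of degree `k` in `m` variables. -/
abbrev HomPoly (m k : ℕ) : Type := ↥(homogeneousSubmodule (Fin m) ℝ k)

theorem sq_mem {m d : ℕ} {q : MvPolynomial (Fin m) ℝ}
    (hq : q ∈ homogeneousSubmodule (Fin m) ℝ d) :
    q ^ 2 ∈ homogeneousSubmodule (Fin m) ℝ (2 * d) := by
  rw [mem_homogeneousSubmodule] at hq ⊢
  rw [mul_comm]
  exact hq.pow 2

/-- The square of a form of degree `d`, as a form of degree `2d`. -/
def sqForm {m d : ℕ} (q : HomPoly m d) : HomPoly m (2 * d) := ⟨q.1 ^ 2, sq_mem q.2⟩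

/-- The form `x^(α+β)` of degree `2d`. -/
def monForm {m d : ℕ} (α β : MultiIndex m d) : HomPoly m (2 * d) :=
  ⟨monomial (α.1 + β.1) 1, by
    rw [mem_homogeneousSubmodule]
    exact isHomogeneous_monomial 1 (by rw [map_add, α.2, β.2, two_mul])⟩

/-- The dual of the cone of sums of squares of forms of degree `d`: the linear functionals on
forms of degree `2d` that are nonnegative on squares. -/
def sosDual (m d : ℕ) : Set (Module.Dual ℝ (HomPoly m (2 * d))) :=
  {ℓ | ∀ q : HomPoly m d, 0 ≤ ℓ (sqForm q)}

/-- The matrix `M(ℓ)` with entries `ℓ(x^(α+β))`. -/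
def momentMatrix {m d : ℕ} (ℓ : Module.Dual ℝ (HomPoly m (2 * d))) : MomMat m d :=
  Matrix.of fun α β => ℓ (monForm α β)

/-- The pseudo-moment cone of degree `2d` in `m` variables, in its matrix realization. -/
def pseudoMomentCone (m d : ℕ) : Set (MomMat m d) := momentMatrix '' sosDual m d

/-- Generalized multivariate Hankel matrices: the entries depend only on `α + β`. -/
def IsHankel {m d : ℕ} (X : MomMat m d) : Prop :=
  ∀ α β α' β' : MultiIndex m d, α.1 + β.1 = α'.1 + β'.1 → X α β = X α' β'

theorem momentMatrix_quadratic {m d : ℕ} (ℓ : Module.Dual ℝ (HomPoly m (2 * d)))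
    (q : HomPoly m d) (c : MultiIndex m d → ℝ) (hc : q.1 = ∑ α, monomial α.1 (c α)) :
    ℓ (sqForm q) = c ⬝ᵥ (momentMatrix ℓ).mulVec c := by
  have h : sqForm q = ∑ α, ∑ β, (c α * c β) • monForm α β := by
    apply Subtype.ext
    simp only [sqForm, hc, sq, Finset.sum_mul_sum, monForm, AddSubmonoidClass.coe_finsetSum,
      Submodule.coe_smul, monomial_mul, smul_monomial, smul_eq_mul, mul_one]
  rw [h]
  simp only [map_sum, map_smul, smul_eq_mul, dotProduct, Matrix.mulVec, momentMatrix,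
    Matrix.of_apply, Finset.mul_sum]
  refine Finset.sum_congr rfl fun α _ => Finset.sum_congr rfl fun β _ => ?_
  ring

theorem sum_monomial_mem {m d : ℕ} (c : MultiIndex m d → ℝ) :
    (∑ α, monomial α.1 (c α)) ∈ homogeneousSubmodule (Fin m) ℝ d :=
  Submodule.sum_mem _ fun α _ => by
    rw [mem_homogeneousSubmodule]
    exact isHomogeneous_monomial _ α.2

theorem eq_sum_monomial {m d : ℕ} (q : HomPoly m d) :
    q.1 = ∑ α : MultiIndex m d, monomial α.1 (coeff α.1 q.1) := by
  ext γ
  rw [coeff_sum]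
  simp only [coeff_monomial]
  by_cases hγ : γ.degree = d
  · rw [Finset.sum_eq_single ⟨γ, hγ⟩]
    · simp
    · intro b _ hb
      rw [if_neg]
      intro h
      exact hb (Subtype.ext h)
    · simp
  · have h0 : coeff γ q.1 = 0 := by
      have hq := (mem_homogeneousSubmodule (σ := Fin m) (R := ℝ) d q.1).1 q.2
      exact hq.coeff_eq_zero hγ
    rw [h0]
    symm
    refine Finset.sum_eq_zero fun b _ => ?_
    rw [if_neg]
    intro h
    exact hγ (h ▸ b.2)

/-- The pseudo-moment cone consists of the positive semidefinite Hankel matrices. -/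
theorem mem_pseudoMomentCone_iff {m d : ℕ} (X : MomMat m d) :
    X ∈ pseudoMomentCone m d ↔ IsHankel X ∧ X.PosSemidef := by
  classical
  constructor
  · rintro ⟨ℓ, hℓ, rfl⟩
    refine ⟨?_, Matrix.PosSemidef.of_dotProduct_mulVec_nonneg ?_ ?_⟩
    · intro α β α' β' h
      simp only [momentMatrix, Matrix.of_apply, monForm, h]
    · ext α β
      simp only [momentMatrix, Matrix.conjTranspose_apply, Matrix.of_apply, star_trivial, monForm,
        add_comm]
    · intro c
      rw [star_trivial, ← momentMatrix_quadratic ℓ ⟨_, sum_monomial_mem c⟩ c rfl]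
      exact hℓ _
  · rintro ⟨hH, hP⟩
    let y : (Fin m →₀ ℕ) → ℝ := fun γ =>
      if h : ∃ p : MultiIndex m d × MultiIndex m d, p.1.1 + p.2.1 = γ then
        X h.choose.1 h.choose.2 else 0
    let ℓ : Module.Dual ℝ (HomPoly m (2 * d)) :=
      ∑ γ : MultiIndex m (2 * d), y γ.1 • (lcoeff ℝ γ.1).comp (Submodule.subtype _)
    have hM : momentMatrix ℓ = X := by
      ext α β
      have hαβ : (α.1 + β.1).degree = 2 * d := by rw [map_add, α.2, β.2, two_mul]
      have hy : y (α.1 + β.1) = X α β := by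
        have hex : ∃ p : MultiIndex m d × MultiIndex m d, p.1.1 + p.2.1 = α.1 + β.1 :=
          ⟨(α, β), rfl⟩
        simp only [y, dif_pos hex]
        exact hH _ _ _ _ hex.choose_spec
      simp only [momentMatrix, Matrix.of_apply, ℓ, LinearMap.sum_apply, LinearMap.smul_apply,
        LinearMap.comp_apply, Submodule.subtype_apply, monForm, lcoeff_apply, coeff_monomial,
        smul_eq_mul]
      rw [Finset.sum_eq_single ⟨α.1 + β.1, hαβ⟩]
      · simp [hy]
      · intro b _ hb
        rw [if_neg, mul_zero]
        intro h
        exact hb (Subtype.ext h.symm)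
      · simp
    refine ⟨ℓ, fun q => ?_, hM⟩
    rw [momentMatrix_quadratic ℓ q _ (eq_sum_monomial q), hM]
    have := hP.dotProduct_mulVec_nonneg fun α : MultiIndex m d => coeff α.1 q.1
    rwa [star_trivial] at this

/-! ### Minimal faces and the extreme ray decomposition algorithm -/

section Algorithm

/-- The minimal face of the convex set `C` containing `x`: the intersection of all faces of `C`
that contain `x`. -/
def minface {E : Type*} [AddCommGroup E] [Module ℝ E] (x : E) (C : Set E) : Set E :=
  ⋂₀ {F | IsExtreme ℝ C F ∧ Convex ℝ F ∧ x ∈ F}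

variable {ι : Type*} [Fintype ι]

/-- The matrices `M` minimizing `⟨B, Y⟩ = tr(BY)` over `Y ∈ F` with `tr Y = 1`. -/
def argminSlice (F : Set (Matrix ι ι ℝ)) (B : Matrix ι ι ℝ) : Set (Matrix ι ι ℝ) :=
  {M | (M ∈ F ∧ M.trace = 1) ∧
    ∀ Y ∈ F, Y.trace = 1 → (B * M).trace ≤ (B * Y).trace}

/-- `t = sup {t ≥ 0 | X - t M ∈ F}`, the supremum being a genuine (finite) one. -/
def IsStepLength (F : Set (Matrix ι ι ℝ)) (X M : Matrix ι ι ℝ) (t : ℝ) : Prop :=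
  IsLUB {t : ℝ | 0 ≤ t ∧ X - t • M ∈ F} t

/-- `r` completed passes through the loop of the algorithm on the input `(C, X₀)`, the matrix
drawn in pass `k` being `B k`. Passes are numbered from `0`; `X k` is the iterate at the start of
pass `k`, and `M k`, `t k` are the matrix and the weight found in pass `k`. Any choice of a
minimizer is allowed. -/
structure IsRun (C : Set (Matrix ι ι ℝ)) (B : ℕ → Matrix ι ι ℝ) (X₀ : Matrix ι ι ℝ) (r : ℕ)
    (X : ℕ → Matrix ι ι ℝ) (t : ℕ → ℝ) (M : ℕ → Matrix ι ι ℝ) : Prop where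
  start : X 0 = X₀
  loop : ∀ k < r, X k ≠ 0
  argmin : ∀ k < r, M k ∈ argminSlice (minface (X k) C) (B k)
  length : ∀ k < r, IsStepLength (minface (X k) C) (X k) (M k) (t k)
  update : ∀ k < r, X (k + 1) = X k - t k • M k

/-- On the input `(C, X₀)` and with the drawn matrices `B`, every execution of the algorithm is
well defined and terminates, and every returned output `r`, `(t_k, M_k)` satisfies `Q`:
no execution gets stuck (a minimizer exists and for every chosen minimizer the step length
exists), no execution loops forever, and `Q` holds for each execution that exits the loop. -/
structure AlwaysReturns (C : Set (Matrix ι ι ℝ)) (B : ℕ → Matrix ι ι ℝ) (X₀ : Matrix ι ι ℝ)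
    (Q : (r : ℕ) → (Fin r → ℝ) → (Fin r → Matrix ι ι ℝ) → Prop) : Prop where
  argmin_nonempty : ∀ r X t M, IsRun C B X₀ r X t M → X r ≠ 0 →
    (argminSlice (minface (X r) C) (B r)).Nonempty
  length_exists : ∀ r X t M, IsRun C B X₀ r X t M → X r ≠ 0 →
    ∀ N ∈ argminSlice (minface (X r) C) (B r),
      ∃ τ : ℝ, IsStepLength (minface (X r) C) (X r) N τ
  terminates : ¬ ∃ X t M, ∀ r, IsRun C B X₀ r X t M
  output : ∀ r X t M, IsRun C B X₀ r X t M → X r = 0 → Q r (fun k => t k) (fun k => M k)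

/-- The symmetric matrix whose entries at `(i, j)` and `(j, i)` are `b s(i, j)`. These free
entries identify the space of symmetric matrices with a coordinate space. -/
def symOfEntries (b : Sym2 ι → ℝ) : Matrix ι ι ℝ := Matrix.of fun i j => b s(i, j)

/-- `B` is a random symmetric matrix whose distribution is absolutely continuous with respect to
Lebesgue measure on the space of symmetric matrices. -/
def IsACRandomSym {Ω : Type*} [MeasurableSpace Ω] (P : Measure Ω) [DecidableEq ι]
    (B : Ω → Matrix ι ι ℝ) : Prop :=
  ∃ b : Ω → Sym2 ι → ℝ, Measurable b ∧ Measure.map b P ≪ (volume : Measure (Sym2 ι → ℝ)) ∧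
    ∀ ω, B ω = symOfEntries (b ω)

end Algorithm

/-- The upper bound on the number of atoms. -/
def atomBound (n d : ℕ) : ℝ :=
  1 / 2 * (((n + d).choose d : ℝ) + 1) - ((n + d).choose d : ℝ)⁻¹ * ((n + 2 * d).choose (2 * d) : ℝ)

/-- The moment matrix `∑ w_i² m_d(z_i) m_d(z_i)ᵀ` of the weighted atoms `p i = (w_i, z_i)`. -/
def atomicMatrix {n s : ℕ} (d : ℕ) (p : Fin s → ℝ × (Fin n → ℝ)) : MomMat (n + 1) d :=
  ∑ i, (p i).1 ^ 2 • momentAtom d (p i).2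

end PseudoMoment

end

open PseudoMoment

/-! Write `v i = momentVec d (z i)` and let `N` be the number of monomials of degree `d` in `n + 1`
variables. The heart of the matter is that, for generic points, the symmetric products `v i v jᵀ + v
j v iᵀ`, `i < j`, are linearly independent modulo Hankel matrices. The symmetric matrices modulo the
Hankel ones have dimension at least `N(N+1)/2 - C(n+2d, 2d)`, and the bound `s ≤ b(n, d)` says
precisely that this number is at least `s * N`. That suffices for an induction
(`exists_pairIndependent`) that adds one point at a time and pays at most `N` dimensions for each.

Given this, let `X` be a pseudo-moment matrix whose kernel contains the orthogonal complement of the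
span of some of the `v i`. Then `X = ∑ D i j • v i v jᵀ`. The diagonal terms are Hankel, so the
off-diagonal part is Hankel too, and pair independence forces it to vanish. Hence any subset of the
atoms spans a simplicial face of the cone, which is the minimal face of each positive combination of
that subset (`SpansSimplicialFace.minface_eq`).

On a simplicial cone the algorithm is transparent. The trace-one slice is a simplex, and an
objective with distinct values at the vertices has a unique minimizer, a normalized atom; the
longest step removes exactly that atom. Ties between two atoms confine `B k` to a proper subspace,
which is a null set. These null sets are fixed in advance and do not depend on the course of the
run, so no assumption on the joint distribution is needed. -/

noncomputable section

namespace PseudoMoment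

/-! ### Polynomial functions and generic conditions -/

section PolyFun

variable {V : Type*} [AddCommGroup V] [Module ℝ V]

theorem linear_mem_polyFun (φ : Module.Dual ℝ V) : (φ : V → ℝ) ∈ polyFun V :=
  Algebra.subset_adjoin ⟨φ, rfl⟩

theorem const_mem_polyFun (c : ℝ) : (fun _ => c : V → ℝ) ∈ polyFun V :=
  (polyFun V).algebraMap_mem c

/-- A polynomial function restricts to a univariate polynomial on every line. -/
theorem exists_polynomial_on_line {f : V → ℝ} (hf : f ∈ polyFun V) (a b : V) :
    ∃ P : Polynomial ℝ, ∀ t : ℝ, f (a + t • b) = P.eval t := by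
  induction hf using Algebra.adjoin_induction with
  | mem f hf =>
    obtain ⟨φ, rfl⟩ := hf
    refine ⟨Polynomial.C (φ a) + Polynomial.X * Polynomial.C (φ b), fun t => ?_⟩
    simp only [map_add, map_smul, smul_eq_mul, Polynomial.eval_add, Polynomial.eval_C,
      Polynomial.eval_mul, Polynomial.eval_X]
  | algebraMap r => exact ⟨Polynomial.C r, fun t => by simp⟩
  | add f g _ _ hf hg =>
    obtain ⟨P, hP⟩ := hf
    obtain ⟨Q, hQ⟩ := hg
    exact ⟨P + Q, fun t => by simp [hP, hQ]⟩
  | mul f g _ _ hf hg =>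
    obtain ⟨P, hP⟩ := hf
    obtain ⟨Q, hQ⟩ := hg
    exact ⟨P * Q, fun t => by simp [hP, hQ]⟩

/-- Restricted to the line through a nonzero of `f` and a nonzero of `g`, both become nonzero
univariate polynomials, and these form a domain. This is what allows finitely many generic
conditions to be imposed at once. -/
theorem exists_mul_ne_zero {f g : V → ℝ} (hf : f ∈ polyFun V) (hg : g ∈ polyFun V)
    (hf0 : ∃ v, f v ≠ 0) (hg0 : ∃ v, g v ≠ 0) : ∃ v, f v * g v ≠ 0 := by
  obtain ⟨a, ha⟩ := hf0
  obtain ⟨b, hb⟩ := hg0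
  obtain ⟨P, hP⟩ := exists_polynomial_on_line hf a (b - a)
  obtain ⟨Q, hQ⟩ := exists_polynomial_on_line hg a (b - a)
  by_contra! h
  have hPQ : P * Q = 0 := Polynomial.funext fun t => by
    rw [Polynomial.eval_mul, ← hP, ← hQ, h, Polynomial.eval_zero]
  rcases mul_eq_zero.1 hPQ with h0 | h0
  · apply ha
    have := hP 0
    rwa [h0, zero_smul, add_zero, Polynomial.eval_zero] at this
  · apply hb
    have := hQ 1
    rwa [h0, one_smul, add_sub_cancel, Polynomial.eval_zero] at this

theorem holdsGenerically_of_ne_zero {P : V → Prop} {f : V → ℝ} (hf : f ∈ polyFun V)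
    (hf0 : ∃ v, f v ≠ 0) (h : ∀ v, f v ≠ 0 → P v) : HoldsGenerically P := by
  refine ⟨{v | f v ≠ 0}, ⟨{f}, Set.finite_singleton f, by simpa using hf, ?_⟩, ?_, h⟩
  · ext v
    simp
  -- Density: an equation `g` of a variety containing the nonvanishing locus of `f` satisfies `f * g
  -- = 0` everywhere, so `g = 0`.
  · rintro S ⟨F, -, hF, rfl⟩ hU
    refine Set.eq_univ_of_forall fun v g hg => ?_
    by_contra hv
    obtain ⟨u, hu⟩ := exists_mul_ne_zero hf (hF hg) hf0 ⟨v, hv⟩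
    exact hu (by rw [hU (left_ne_zero_of_mul hu) g hg, mul_zero])

/-- Maps into a vector space all of whose coordinates are polynomial functions. -/
def IsPolyMap {W : Type*} [AddCommGroup W] [Module ℝ W] (f : V → W) : Prop :=
  ∀ φ : Module.Dual ℝ W, (fun v => φ (f v)) ∈ polyFun V

variable {W : Type*} [AddCommGroup W] [Module ℝ W] {U : Type*} [AddCommGroup U] [Module ℝ U]

theorem comp_linear_mem_polyFun {f : W → ℝ} (hf : f ∈ polyFun W) (L : V →ₗ[ℝ] W) :
    (fun v => f (L v)) ∈ polyFun V := by
  induction hf using Algebra.adjoin_induction with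
  | mem f hf =>
    obtain ⟨φ, rfl⟩ := hf
    exact linear_mem_polyFun (φ ∘ₗ L)
  | algebraMap r => exact const_mem_polyFun r
  | add f g _ _ hf hg => exact (polyFun V).add_mem hf hg
  | mul f g _ _ hf hg => exact (polyFun V).mul_mem hf hg

theorem IsPolyMap.comp_linear {f : W → U} (hf : IsPolyMap f) (L : V →ₗ[ℝ] W) :
    IsPolyMap fun v => f (L v) := fun φ => comp_linear_mem_polyFun (hf φ) L

theorem isPolyMap_pi {ι : Type*} [Fintype ι] {f : V → ι → ℝ}
    (hf : ∀ i, (fun v => f v i) ∈ polyFun V) : IsPolyMap f := by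
  classical
  intro φ
  have h : (fun v => φ (f v)) = ∑ i, (fun v => f v i) * fun _ => φ (Pi.single i 1) := by
    ext v
    rw [LinearMap.pi_apply_eq_sum_univ φ (f v), Finset.sum_apply]
    refine Finset.sum_congr rfl fun i _ => ?_
    simp only [smul_eq_mul, Pi.mul_apply]
    congr 2
    ext j
    simp [Pi.single_apply, eq_comm]
  rw [h]
  exact Subalgebra.sum_mem _ fun i _ => (polyFun V).mul_mem (hf i) (const_mem_polyFun _)

theorem IsPolyMap.bilin {X Y : Type*} [AddCommGroup X] [Module ℝ X] [FiniteDimensional ℝ X]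
    [AddCommGroup Y] [Module ℝ Y] [FiniteDimensional ℝ Y] {f : V → X} {g : V → Y}
    (hf : IsPolyMap f) (hg : IsPolyMap g) (Φ : X →ₗ[ℝ] Y →ₗ[ℝ] W) :
    IsPolyMap fun v => Φ (f v) (g v) := by
  intro φ
  let b := Module.finBasis ℝ X
  let c := Module.finBasis ℝ Y
  have h : (fun v => φ (Φ (f v) (g v))) = ∑ i, ∑ j, (fun v => b.coord i (f v)) *
      (fun v => c.coord j (g v)) * fun _ => φ (Φ (b i) (c j)) := by
    ext v
    simp only [Finset.sum_apply, Pi.mul_apply]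
    conv_lhs => rw [← b.sum_repr (f v), ← c.sum_repr (g v)]
    simp only [map_sum, map_smul, LinearMap.sum_apply, LinearMap.smul_apply, smul_eq_mul,
      Module.Basis.coord_apply, mul_assoc, Finset.mul_sum]
    rw [Finset.sum_comm]
    exact Finset.sum_congr rfl fun i _ => Finset.sum_congr rfl fun j _ => by ring
  rw [h]
  exact Subalgebra.sum_mem _ fun i _ => Subalgebra.sum_mem _ fun j _ =>
    (polyFun V).mul_mem ((polyFun V).mul_mem (hf _) (hg _)) (const_mem_polyFun _)

/-- Linear independence of finitely many polynomial maps is a Zariski-open condition. -/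
theorem exists_polyFun_linearIndependent {J : Type*} [Fintype J] {f : J → V → W}
    (hf : ∀ j, IsPolyMap (f j)) {v₀ : V} (h₀ : LinearIndependent ℝ fun j => f j v₀) :
    ∃ g ∈ polyFun V, g v₀ ≠ 0 ∧ ∀ v, g v ≠ 0 → LinearIndependent ℝ fun j => f j v := by
  classical
  -- `L` reads off coordinates with respect to the independent family at `v₀`. The determinant of
  -- the resulting square matrix is polynomial in `v` and equals `1` at `v₀`; where it is nonzero,
  -- independence holds already after `L`.
  obtain ⟨L, hL⟩ : ∃ L : W →ₗ[ℝ] (J →₀ ℝ), ∀ j, L (f j v₀) = Finsupp.single j 1 := by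
    obtain ⟨L, hL⟩ := (Finsupp.linearCombination ℝ fun j => f j v₀).exists_leftInverse_of_injective
      (LinearMap.ker_eq_bot.2 h₀)
    refine ⟨L, fun j => ?_⟩
    have := LinearMap.congr_fun hL (Finsupp.single j 1)
    simpa using this
  let A : V → Matrix J J ℝ := fun v => Matrix.of fun i j => L (f j v) i
  refine ⟨fun v => (A v).det, ?_, ?_, ?_⟩
  · have h : (fun v => (A v).det) = ∑ σ : Equiv.Perm J, (fun _ => ((Equiv.Perm.sign σ : ℤ) : ℝ)) *
        ∏ i, fun v => A v (σ i) i := by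
      ext v
      simp [Matrix.det_apply, Finset.sum_apply, Finset.prod_apply, Units.smul_def]
    rw [h]
    refine Subalgebra.sum_mem _ fun σ _ => (polyFun V).mul_mem (const_mem_polyFun _)
      (Subalgebra.prod_mem _ fun i _ => ?_)
    exact hf i (Finsupp.lapply (σ i) ∘ₗ L)
  · have : A v₀ = 1 := by
      ext i j
      simp [A, hL, Matrix.one_apply, Finsupp.single_apply, eq_comm]
    simp [this]
  · intro v hv
    have h1 : LinearIndependent ℝ (A v).col :=
      Matrix.linearIndependent_cols_iff_isUnit.2 ((A v).isUnit_iff_isUnit_det.2 (Ne.isUnit hv))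
    exact LinearIndependent.of_comp (Finsupp.lcoeFun ∘ₗ L) h1

end PolyFun

/-! ### Independence of pairwise products -/

section Independence

variable {V W : Type*} [AddCommGroup V] [Module ℝ V] [AddCommGroup W] [Module ℝ W]

/-- The products `Φ xᵢ xⱼ`, `i < j`, are linearly independent. -/
def PairIndependent (Φ : V →ₗ[ℝ] V →ₗ[ℝ] W) {s : ℕ} (x : Fin s → V) : Prop :=
  LinearIndependent ℝ fun q : {q : Fin s × Fin s // q.1 < q.2} => Φ (x q.1.1) (x q.1.2)

theorem pairIndependent_iff (Φ : V →ₗ[ℝ] V →ₗ[ℝ] W) {s : ℕ} (x : Fin s → V) :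
    PairIndependent Φ x ↔ ∀ c : Fin s → Fin s → ℝ,
      (∑ i, ∑ j, if i < j then c i j • Φ (x i) (x j) else 0) = 0 → ∀ i j, i < j → c i j = 0 := by
  have key : ∀ c : Fin s → Fin s → ℝ,
      (∑ i, ∑ j, if i < j then c i j • Φ (x i) (x j) else 0) =
        ∑ q : {q : Fin s × Fin s // q.1 < q.2}, c q.1.1 q.1.2 • Φ (x q.1.1) (x q.1.2) := by
    intro c
    rw [← Fintype.sum_prod_type' (f := fun i j => if i < j then c i j • Φ (x i) (x j) else 0),
      ← Finset.sum_filter]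
    exact (Finset.sum_subtype _ (by simp) fun q : Fin s × Fin s => c q.1 q.2 • Φ (x q.1) (x q.2))
  rw [PairIndependent, Fintype.linearIndependent_iff]
  constructor
  · intro h c hc i j hij
    rw [key] at hc
    exact h (fun q => c q.1.1 q.1.2) hc ⟨(i, j), hij⟩
  · intro h g hg q
    have := h (fun i j => if hij : i < j then g ⟨(i, j), hij⟩ else 0) (by
      rw [key, ← hg]
      exact Finset.sum_congr rfl fun q _ => by simp [q.2]) q.1.1 q.1.2 q.2
    simpa [q.2] using this

variable [FiniteDimensional ℝ W]

theorem finrank_biSup_le {J : Type*} (S : Finset J) (p : J → Submodule ℝ W) (m : ℕ)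
    (h : ∀ j ∈ S, Module.finrank ℝ (p j) ≤ m) :
    Module.finrank ℝ ↥(⨆ j ∈ S, p j) ≤ S.card * m := by
  classical
  induction S using Finset.induction_on with
  | empty => simp
  | insert a S ha ih =>
    rw [Finset.iSup_insert, Finset.card_insert_of_notMem ha, add_mul, one_mul, add_comm]
    exact (Submodule.finrank_add_le_finrank_add_finrank _ _).trans
      (add_le_add (h a (Finset.mem_insert_self a S))
        (ih fun j hj => h j (Finset.mem_insert_of_mem hj)))

/-- If the values of `Φ` span a large space, then some `Φ x` with `x` in a given spanning set has
large rank. -/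
theorem exists_le_finrank_range [FiniteDimensional ℝ V] (hV : 0 < Module.finrank ℝ V) (Φ : V →ₗ[ℝ] V →ₗ[ℝ] W)
    (hΦ : Submodule.span ℝ (Set.range fun q : V × V => Φ q.1 q.2) = ⊤) {S : Set V}
    (hS : Submodule.span ℝ S = ⊤) (hS0 : S.Nonempty) {s : ℕ}
    (hs : s * Module.finrank ℝ V ≤ Module.finrank ℝ W) :
    ∃ x ∈ S, s ≤ Module.finrank ℝ (LinearMap.range (Φ x)) := by
  classical
  rcases s.eq_zero_or_pos with rfl | hs0
  · obtain ⟨x, hx⟩ := hS0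
    exact ⟨x, hx, Nat.zero_le _⟩
  by_contra! h
  -- Dimension count: for `dim V` elements of `S` spanning `V`, the ranges of `Φ (f j)` together
  -- span `W`. Were all ranks at most `s - 1`, this would give `dim W ≤ dim V * (s - 1) < s * dim
  -- V`.
  obtain ⟨f, hfS, hf, -⟩ := Submodule.exists_fun_fin_finrank_span_eq ℝ S
  replace hf := hf.trans hS
  have htop : (⨆ j ∈ (Finset.univ : Finset (Fin (Module.finrank ℝ ↥(Submodule.span ℝ S)))),
      LinearMap.range (Φ (f j))) = ⊤ := by
    rw [eq_top_iff, ← hΦ, Submodule.span_le]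
    rintro _ ⟨⟨x, y⟩, rfl⟩
    have hx : x ∈ Submodule.span ℝ (Set.range f) := hf ▸ Submodule.mem_top
    simp only [SetLike.mem_coe]
    induction hx using Submodule.span_induction with
    | mem x hx =>
      obtain ⟨j, rfl⟩ := hx
      exact Submodule.mem_iSup_of_mem j (Submodule.mem_iSup_of_mem (Finset.mem_univ j) ⟨y, rfl⟩)
    | zero => simp
    | add a b _ _ ha hb => simpa using Submodule.add_mem _ ha hb
    | smul c a _ ha => simpa using Submodule.smul_mem _ c ha
  have hle := finrank_biSup_le Finset.univ (fun j => LinearMap.range (Φ (f j))) (s - 1)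
    fun j _ => Nat.le_sub_one_of_lt (h _ (hfS j))
  rw [htop, finrank_top, Finset.card_univ, Fintype.card_fin, hS, finrank_top] at hle
  have : Module.finrank ℝ V * (s - 1) < s * Module.finrank ℝ V := by
    rw [mul_comm]
    exact Nat.mul_lt_mul_of_pos_right (by omega) hV
  omega

variable {Z : Type*}
theorem exists_linearIndependent_comp {X Y : Type*} [AddCommGroup X] [Module ℝ X]
    [AddCommGroup Y] [Module ℝ Y] [FiniteDimensional ℝ Y] {γ : Z → X}
    (hγ : Submodule.span ℝ (Set.range γ) = ⊤) (L : X →ₗ[ℝ] Y) {s : ℕ}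
    (hs : s ≤ Module.finrank ℝ (LinearMap.range L)) :
    ∃ z : Fin s → Z, LinearIndependent ℝ fun i => L (γ (z i)) := by
  have h1 : Submodule.span ℝ (Set.range fun z => L (γ z)) = LinearMap.range L := by
    rw [show (fun z => L (γ z)) = L ∘ γ from rfl, Set.range_comp, Submodule.span_image, hγ,
      Submodule.map_top]
  obtain ⟨f, hfS, -, hf⟩ := Submodule.exists_fun_fin_finrank_span_eq ℝ (Set.range fun z => L (γ z))
  rw [← h1] at hs
  choose g hg using hfS
  refine ⟨fun i => g (Fin.castLE hs i), ?_⟩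
  simp only [hg]
  exact hf.comp _ (Fin.castLE_injective hs)

/-- Induction on `s`, with `W` arbitrary because the step passes to a quotient. Choose `z₀` with `Φ
(γ z₀)` of large rank and divide `W` by its range `R`, whose dimension is at most `dim V`. The other
points must be pair independent modulo `R` and have independent images under `Φ (γ z₀)`. Each
condition is open and satisfiable, hence so is their conjunction. -/
theorem exists_pairIndependent [FiniteDimensional ℝ V] [AddCommGroup Z] [Module ℝ Z] {γ : Z → V}
    (hV : 0 < Module.finrank ℝ V) (hγ : IsPolyMap γ)
    (hspan : Submodule.span ℝ (Set.range γ) = ⊤) (s : ℕ) :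
    ∀ {W : Type*} [AddCommGroup W] [Module ℝ W] [FiniteDimensional ℝ W]
      (Φ : V →ₗ[ℝ] V →ₗ[ℝ] W)
      (_ : Submodule.span ℝ (Set.range fun q : V × V => Φ q.1 q.2) = ⊤)
      (_ : s * Module.finrank ℝ V ≤ Module.finrank ℝ W),
      ∃ z : Fin s → Z, PairIndependent Φ fun i => γ (z i) := by
  induction s with
  | zero =>
    intro W _ _ _ Φ _ _
    exact ⟨Fin.elim0, (pairIndependent_iff _ _).2 fun c _ i => i.elim0⟩
  | succ s ih =>
    intro W _ _ _ Φ hΦ hW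
    obtain ⟨_, ⟨z₀, rfl⟩, hz₀⟩ :=
      exists_le_finrank_range hV Φ hΦ hspan (Set.range_nonempty γ) hW
    set R := LinearMap.range (Φ (γ z₀)) with hR
    let Ψ : V →ₗ[ℝ] V →ₗ[ℝ] W ⧸ R := Φ.compr₂ R.mkQ
    have hΨ : Submodule.span ℝ (Set.range fun q : V × V => Ψ q.1 q.2) = ⊤ := by
      have : (fun q : V × V => Ψ q.1 q.2) = R.mkQ ∘ fun q : V × V => Φ q.1 q.2 := rfl
      rw [this, Set.range_comp, Submodule.span_image, hΦ, Submodule.map_top, Submodule.range_mkQ]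
    have hdim : s * Module.finrank ℝ V ≤ Module.finrank ℝ (W ⧸ R) := by
      have h1 := Submodule.finrank_quotient_add_finrank R
      have h2 : Module.finrank ℝ R ≤ Module.finrank ℝ V := LinearMap.finrank_range_le _
      rw [add_mul, one_mul] at hW
      omega
    obtain ⟨z₁, hz₁⟩ := ih Ψ hΨ hdim
    obtain ⟨z₂, hz₂⟩ := exists_linearIndependent_comp hspan (Φ (γ z₀)) ((Nat.le_succ s).trans hz₀)
    have hpoly : ∀ i, IsPolyMap fun z : Fin s → Z => γ (z i) := fun i =>
      hγ.comp_linear (LinearMap.proj (φ := fun _ => Z) i)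
    obtain ⟨g₁, hg₁, hg₁0, h₁⟩ := exists_polyFun_linearIndependent
      (fun q : {q : Fin s × Fin s // q.1 < q.2} => (hpoly q.1.1).bilin (hpoly q.1.2) Ψ) hz₁
    obtain ⟨g₂, hg₂, hg₂0, h₂⟩ := exists_polyFun_linearIndependent
      (fun i => (fun φ => hpoly i (φ ∘ₗ Φ (γ z₀)) :
        IsPolyMap fun z : Fin s → Z => Φ (γ z₀) (γ (z i)))) hz₂
    obtain ⟨z, hz⟩ := exists_mul_ne_zero hg₁ hg₂ ⟨_, hg₁0⟩ ⟨_, hg₂0⟩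
    have hz₁' : PairIndependent Ψ fun i => γ (z i) := h₁ z (left_ne_zero_of_mul hz)
    have hz₂' := Fintype.linearIndependent_iff.1 (h₂ z (right_ne_zero_of_mul hz))
    rw [pairIndependent_iff] at hz₁'
    refine ⟨Fin.cons z₀ z, (pairIndependent_iff _ _).2 fun c hc => ?_⟩
    simp only [Fin.sum_univ_succ, Fin.cons_zero, Fin.cons_succ, if_false,
      Fin.succ_pos, if_true, Fin.not_lt_zero, Fin.succ_lt_succ_iff, zero_add] at hc
    -- Modulo `R` the terms containing the new point disappear, leaving a relation among the old
    -- pairs.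
    have hc₁ : ∀ i j, i < j → c (Fin.succ i) (Fin.succ j) = 0 := by
      refine hz₁' (fun i j => c i.succ j.succ) ?_
      have := congrArg R.mkQ hc
      rw [map_add, map_zero, (R.mkQ_apply _).trans ((Submodule.Quotient.mk_eq_zero R).2 (R.sum_mem
        fun i _ => R.smul_mem _ ⟨γ (z i), rfl⟩)), zero_add, map_sum] at this
      refine Eq.trans ?_ this
      refine Finset.sum_congr rfl fun i _ => ?_
      rw [map_sum]
      refine Finset.sum_congr rfl fun j _ => ?_
      split_ifs
      · rw [map_smul]
        rfl
      · rw [map_zero]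
    have hc₂ : ∀ j, c 0 (Fin.succ j) = 0 := by
      refine hz₂' (fun j => c 0 (Fin.succ j)) ?_
      rw [← hc]
      symm
      rw [add_eq_left]
      refine Finset.sum_eq_zero fun i _ => Finset.sum_eq_zero fun j _ => ?_
      split_ifs with hij
      · rw [hc₁ i j hij, zero_smul]
      · rfl
    intro i j hij
    induction j using Fin.cases with
    | zero => exact absurd hij (Fin.not_lt_zero i)
    | succ j =>
      induction i using Fin.cases with
      | zero => exact hc₂ j
      | succ i => exact hc₁ i j (Fin.succ_lt_succ_iff.1 hij)

end Independence

/-! ### Moment vectors -/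

section Moment

theorem card_multiIndex (n k : ℕ) : Fintype.card (MultiIndex (n + 1) k) = (n + k).choose k := by
  have h : Fintype.card (MultiIndex (n + 1) k) =
      (Finset.finsuppAntidiag (Finset.univ : Finset (Fin (n + 1))) k).card :=
    Fintype.subtype_card _ _
  rw [h, Finset.card_finsuppAntidiag_nat_eq_choose]
  simp

theorem momentVec_apply {n d : ℕ} (z : Fin n → ℝ) (α : MultiIndex (n + 1) d) :
    momentVec d z α = ∏ i : Fin n, z i ^ α.1 i.succ := by
  simp [momentVec, homMomentVec, Fin.prod_univ_succ]

theorem momentVec_ne_zero {n : ℕ} (d : ℕ) (z : Fin n → ℝ) : momentVec d z ≠ 0 := by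
  intro h
  have := congrFun h ⟨Finsupp.single 0 d, by simp⟩
  rw [momentVec_apply] at this
  simp at this

theorem isPolyMap_momentVec (n d : ℕ) :
    IsPolyMap fun p : ℝ × (Fin n → ℝ) => momentVec d p.2 := by
  refine isPolyMap_pi fun α => ?_
  have h : (fun p : ℝ × (Fin n → ℝ) => momentVec d p.2 α) =
      ∏ i : Fin n, (fun p : ℝ × (Fin n → ℝ) => p.2 i) ^ α.1 i.succ := by
    ext p
    simp [momentVec_apply, Finset.prod_apply]
  rw [h]
  exact Subalgebra.prod_mem _ fun i _ => (polyFun _).pow_mem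
    (linear_mem_polyFun (LinearMap.proj (φ := fun _ => ℝ) i ∘ₗ LinearMap.snd ℝ ℝ (Fin n → ℝ))) _

/-- The exponent of the homogenizing variable is determined by the others, since the total degree is
`d`. -/
theorem tail_injective {n d : ℕ} :
    Function.Injective fun α : MultiIndex (n + 1) d => Finsupp.tail α.1 := by
  intro α β h
  have hs : ∀ i : Fin n, α.1 i.succ = β.1 i.succ := fun i => DFunLike.congr_fun h i
  have hα := α.2
  have hβ := β.2
  rw [Finsupp.degree_eq_sum, Fin.sum_univ_succ] at hα hβ
  have hsum : ∑ i : Fin n, α.1 i.succ = ∑ i : Fin n, β.1 i.succ :=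
    Finset.sum_congr rfl fun i _ => hs i
  ext i
  induction i using Fin.cases with
  | zero => omega
  | succ i => exact hs i

/-- A functional vanishing on every moment vector is the coefficient list of a polynomial vanishing
on `ℝ^n`, which is therefore zero; distinct indices give distinct monomials. -/
theorem span_momentVec (n d : ℕ) :
    Submodule.span ℝ (Set.range fun p : ℝ × (Fin n → ℝ) => momentVec d p.2) = ⊤ := by
  classical
  by_contra hne
  obtain ⟨f, hf, hle⟩ := Submodule.exists_le_ker_of_lt_top _ (lt_top_iff_ne_top.2 hne)
  let c : MultiIndex (n + 1) d → ℝ := fun α => f (Pi.single α 1)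
  have hfc : ∀ x, f x = ∑ α, x α * c α := fun x => by
    rw [LinearMap.pi_apply_eq_sum_univ f x]
    refine Finset.sum_congr rfl fun α _ => ?_
    simp only [smul_eq_mul, c]
    congr 2
    ext j
    simp [Pi.single_apply, eq_comm]
  have h0 : (∑ α, monomial (Finsupp.tail α.1) (c α) : MvPolynomial (Fin n) ℝ) = 0 := by
    refine MvPolynomial.funext fun z => ?_
    have hz : f (momentVec d z) = 0 := hle (Submodule.subset_span ⟨(0, z), rfl⟩)
    rw [hfc] at hz
    rw [map_zero, map_sum, ← hz]
    refine Finset.sum_congr rfl fun α _ => ?_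
    rw [eval_monomial, momentVec_apply, mul_comm, Finsupp.prod_fintype _ _ fun i => pow_zero _]
    rfl
  apply hf
  ext α
  have hα := congrArg (coeff (Finsupp.tail α.1)) h0
  rw [coeff_sum, coeff_zero, Finset.sum_eq_single α] at hα
  · simpa [coeff_monomial, c] using hα
  · intro β _ hβ
    rw [coeff_monomial, if_neg fun h => hβ (tail_injective h)]
  · simp

end Moment

/-! ### Symmetric matrices modulo Hankel matrices -/

section Hankel

/-- The space of generalized Hankel matrices. -/
def hankelSubmodule (m d : ℕ) : Submodule ℝ (MomMat m d) where
  carrier := {X | IsHankel X}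
  add_mem' hX hY α β α' β' h := by simp [hX α β α' β' h, hY α β α' β' h]
  zero_mem' _ _ _ _ _ := rfl
  smul_mem' c X hX α β α' β' h := by simp [hX α β α' β' h]

theorem isHankel_momentAtom {n d : ℕ} (z : Fin n → ℝ) : IsHankel (momentAtom d z) := by
  have key : ∀ α β : MultiIndex (n + 1) d, momentAtom d z α β =
      ∏ i, (Fin.cons 1 z : Fin (n + 1) → ℝ) i ^ (α.1 + β.1) i := fun α β => by
    simp [momentAtom, Matrix.vecMulVec_apply, momentVec, homMomentVec, ← Finset.prod_mul_distrib,
      pow_add]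
  intro α β α' β' h
  rw [key, key, h]

variable {ι : Type*}

/-- The identification of the entries with the symmetric matrix, as a linear map. -/
def symOfEntriesₗ (ι : Type*) : (Sym2 ι → ℝ) →ₗ[ℝ] Matrix ι ι ℝ where
  toFun b := Matrix.of fun i j => b s(i, j)
  map_add' _ _ := rfl
  map_smul' _ _ := rfl

/-- The entries of `x yᵀ + y xᵀ`. -/
def symPair (ι : Type*) : (ι → ℝ) →ₗ[ℝ] (ι → ℝ) →ₗ[ℝ] (Sym2 ι → ℝ) :=
  LinearMap.mk₂ ℝ (fun x y e => e.lift ⟨fun i j => x i * y j + x j * y i, fun i j => by ring⟩)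
    (fun x x' y => by ext e; induction e; simp; ring)
    (fun c x y => by ext e; induction e; simp; ring)
    (fun x y y' => by ext e; induction e; simp; ring)
    (fun c x y => by ext e; induction e; simp; ring)

theorem symPair_apply (x y : ι → ℝ) (i j : ι) :
    symPair ι x y s(i, j) = x i * y j + x j * y i := rfl

theorem symOfEntriesₗ_symPair (x y : ι → ℝ) :
    symOfEntriesₗ ι (symPair ι x y) = Matrix.vecMulVec x y + Matrix.vecMulVec y x := by
  ext i j
  change symPair ι x y s(i, j) = _
  rw [symPair_apply, Matrix.add_apply, Matrix.vecMulVec_apply, Matrix.vecMulVec_apply, mul_comm (y i)]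

theorem span_symPair (ι : Type*) [Fintype ι] :
    Submodule.span ℝ (Set.range fun q : (ι → ℝ) × (ι → ℝ) => symPair ι q.1 q.2) = ⊤ := by
  classical
  rw [eq_top_iff]
  intro b _
  rw [pi_eq_sum_univ' b]
  refine Submodule.sum_mem _ fun e _ => Submodule.smul_mem _ _ ?_
  induction e with
  | _ i j =>
    have h : Pi.single s(i, j) (1 : ℝ) =
        -- `symPair` counts a diagonal entry twice, whence the factor `1 / 2`.
        (if i = j then (1 / 2 : ℝ) else 1) • symPair ι (Pi.single i 1) (Pi.single j 1) := by
      ext e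
      induction e with
      | _ k l =>
        rw [Pi.smul_apply, symPair_apply]
        simp only [Pi.single_apply, Sym2.eq_iff, smul_eq_mul]
        by_cases hij : i = j
        · subst hij
          by_cases hk : k = i <;> by_cases hl : l = i <;> simp [hk, hl]
          norm_num
        · by_cases hk : k = i <;> by_cases hl : l = i <;> by_cases hk' : k = j <;>
            by_cases hl' : l = j <;> simp_all
    rw [h]
    exact Submodule.smul_mem _ _ (Submodule.subset_span ⟨(Pi.single i 1, Pi.single j 1), rfl⟩)

/-- The entries of the symmetric Hankel matrices. -/
def hankelEntries (m d : ℕ) : Submodule ℝ (Sym2 (MultiIndex m d) → ℝ) :=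
  (hankelSubmodule m d).comap (symOfEntriesₗ _)

/-- A Hankel matrix is determined by one number for each exponent of degree `2d`, read at a chosen
decomposition `α + β`. Injectivity only tests exponents that have one, so the default `0` is
harmless. -/
theorem finrank_hankelEntries_le (m d : ℕ) :
    Module.finrank ℝ (hankelEntries m d) ≤ Fintype.card (MultiIndex m (2 * d)) := by
  classical
  let L : hankelEntries m d →ₗ[ℝ] MultiIndex m (2 * d) → ℝ :=
    { toFun := fun b γ =>
        if h : ∃ p : MultiIndex m d × MultiIndex m d, p.1.1 + p.2.1 = γ.1 then
          b.1 s(h.choose.1, h.choose.2) else 0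
      map_add' := fun b c => by
        ext γ
        simp only [Pi.add_apply]
        split_ifs <;> simp
      map_smul' := fun r b => by
        ext γ
        simp only [Pi.smul_apply]
        split_ifs <;> simp }
  have hL : Function.Injective L := by
    rw [injective_iff_map_eq_zero]
    intro b hb
    apply Subtype.ext
    ext e
    induction e with
    | _ α β =>
      have hex : ∃ p : MultiIndex m d × MultiIndex m d, p.1.1 + p.2.1 = α.1 + β.1 := ⟨(α, β), rfl⟩
      have h := congrFun hb ⟨α.1 + β.1, by rw [map_add, α.2, β.2, two_mul]⟩
      simp only [L, LinearMap.coe_mk, AddHom.coe_mk, dif_pos hex] at h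
      exact (b.2 _ _ _ _ hex.choose_spec.symm).trans h
  simpa using LinearMap.finrank_le_finrank_of_injective hL

/-- The product of two vectors, as an entry vector modulo Hankel matrices. -/
def hankelPair (m d : ℕ) : (MultiIndex m d → ℝ) →ₗ[ℝ] (MultiIndex m d → ℝ) →ₗ[ℝ]
    (Sym2 (MultiIndex m d) → ℝ) ⧸ hankelEntries m d :=
  (symPair _).compr₂ (hankelEntries m d).mkQ

theorem span_hankelPair (m d : ℕ) : Submodule.span ℝ (Set.range
    fun q : (MultiIndex m d → ℝ) × (MultiIndex m d → ℝ) => hankelPair m d q.1 q.2) = ⊤ := by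
  have : (fun q : (MultiIndex m d → ℝ) × (MultiIndex m d → ℝ) => hankelPair m d q.1 q.2) =
    (hankelEntries m d).mkQ ∘ fun q => symPair _ q.1 q.2 := rfl
  rw [this, Set.range_comp, Submodule.span_image, span_symPair, Submodule.map_top,
    Submodule.range_mkQ]

theorem sum_sum_eq_offDiag_add_diag {M : Type*} [AddCommMonoid M] {s : ℕ} (f : Fin s → Fin s → M) :
    ∑ i, ∑ j, f i j = (∑ i, ∑ j, if i < j then f i j + f j i else 0) + ∑ i, f i i := by
  have h1 : ∀ i j, f i j = ((if i < j then f i j else 0) + if j < i then f i j else 0) +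
      if i = j then f i j else 0 := by
    intro i j
    rcases lt_trichotomy i j with h | h | h
    · simp [h, h.not_gt, h.ne]
    · simp [h]
    · simp [h, h.not_gt, h.ne']
  have h2 : ∀ i j, (if i < j then f i j + f j i else 0) =
      (if i < j then f i j else 0) + if i < j then f j i else 0 := by
    intro i j
    split_ifs <;> simp
  simp_rw [h2, Finset.sum_add_distrib]
  rw [Finset.sum_comm (f := fun i j => if i < j then f j i else 0)]
  simp_rw [← Finset.sum_add_distrib]
  refine Finset.sum_congr rfl fun i _ => ?_
  rw [Finset.sum_congr rfl fun j _ => h1 i j, Finset.sum_add_distrib]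
  simp

/-- Subtracting the Hankel diagonal part leaves a combination of the `symPair (v i) (v j)`, `i < j`,
that is zero modulo Hankel matrices. -/
theorem eq_zero_of_isHankel {m d s : ℕ} {v : Fin s → MultiIndex m d → ℝ}
    (hv : PairIndependent (hankelPair m d) v) (hatom : ∀ i, IsHankel (Matrix.vecMulVec (v i) (v i)))
    {C : Fin s → Fin s → ℝ} (hC : ∀ i j, C i j = C j i)
    (hX : IsHankel (∑ i, ∑ j, C i j • Matrix.vecMulVec (v i) (v j))) {i j : Fin s} (hij : i ≠ j) :
    C i j = 0 := by
  rw [pairIndependent_iff] at hv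
  suffices h : ∀ i j, i < j → C i j = 0 by
    rcases lt_or_gt_of_ne hij with hlt | hlt
    · exact h i j hlt
    · rw [hC]
      exact h j i hlt
  refine hv C ?_
  let b : Sym2 (MultiIndex m d) → ℝ :=
    ∑ i, ∑ j, if i < j then C i j • symPair _ (v i) (v j) else 0
  have hb : (∑ i, ∑ j, if i < j then C i j • hankelPair m d (v i) (v j) else 0) =
      (hankelEntries m d).mkQ b := by
    simp only [b, map_sum]
    refine Finset.sum_congr rfl fun i _ => Finset.sum_congr rfl fun j _ => ?_
    split_ifs
    · rw [map_smul]
      rfl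
    · rw [map_zero]
  rw [hb, Submodule.mkQ_apply, Submodule.Quotient.mk_eq_zero]
  change symOfEntriesₗ _ b ∈ hankelSubmodule m d
  have hb' : symOfEntriesₗ _ b = (∑ i, ∑ j, C i j • Matrix.vecMulVec (v i) (v j)) -
      ∑ i, C i i • Matrix.vecMulVec (v i) (v i) := by
    rw [eq_sub_iff_add_eq, sum_sum_eq_offDiag_add_diag
      fun i j => C i j • Matrix.vecMulVec (v i) (v j)]
    congr 1
    simp only [b, map_sum]
    refine Finset.sum_congr rfl fun i _ => Finset.sum_congr rfl fun j _ => ?_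
    split_ifs
    · rw [map_smul, symOfEntriesₗ_symPair, smul_add, hC j i]
    · rw [map_zero]
  rw [hb']
  exact Submodule.sub_mem _ hX
    (Submodule.sum_mem _ fun i _ => Submodule.smul_mem _ _ (hatom i))

/-- The weighted moment vectors generically are in the position that the algorithm needs. -/
theorem holdsGenerically_momentVec {n d s : ℕ} (hs : (s : ℝ) ≤ atomBound n d) :
    HoldsGenerically fun p : Fin s → ℝ × (Fin n → ℝ) =>
      (∀ i, (p i).1 ≠ 0) ∧ LinearIndependent ℝ (fun i => momentVec d (p i).2) ∧
        PairIndependent (hankelPair (n + 1) d) fun i => momentVec d (p i).2 := by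
  set N := (n + d).choose d with hN
  have hNpos : 0 < N := Nat.choose_pos (by omega)
  have hN1 : (1 : ℝ) ≤ N := by exact_mod_cast hNpos
  have hcard : Module.finrank ℝ (MultiIndex (n + 1) d → ℝ) = N := by
    rw [Module.finrank_fintype_fun_eq_card, card_multiIndex]
  -- The hypothesis multiplied by `N`: this is the dimension inequality that the induction requires.
  have hsN : s * N + (n + 2 * d).choose (2 * d) ≤ (N + 1).choose 2 := by
    rw [← Nat.cast_le (α := ℝ), Nat.cast_add, Nat.cast_mul, Nat.cast_choose_two]
    rw [atomBound, ← hN] at hs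
    have := mul_le_mul_of_nonneg_right hs (zero_le_one.trans hN1)
    rw [sub_mul, mul_right_comm (N : ℝ)⁻¹, inv_mul_cancel₀ (by positivity), one_mul] at this
    push_cast
    linarith
  have hsN' : s ≤ N := by
    have h1 : (s : ℝ) ≤ N := by
      rw [atomBound, ← hN] at hs
      have : 0 ≤ (N : ℝ)⁻¹ * ((n + 2 * d).choose (2 * d) : ℝ) := by positivity
      linarith
    exact_mod_cast h1
  have hpoly : ∀ i, IsPolyMap fun p : Fin s → ℝ × (Fin n → ℝ) => momentVec d (p i).2 := fun i =>
    (isPolyMap_momentVec n d).comp_linear (LinearMap.proj (φ := fun _ => ℝ × (Fin n → ℝ)) i)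
  obtain ⟨p₁, hp₁⟩ := exists_linearIndependent_comp (span_momentVec n d) LinearMap.id (s := s)
    (by rw [LinearMap.range_id, finrank_top, hcard]; exact hsN')
  obtain ⟨p₂, hp₂⟩ := exists_pairIndependent (by rw [hcard]; exact hNpos)
    (isPolyMap_momentVec n d) (span_momentVec n d) s (hankelPair (n + 1) d)
    (span_hankelPair _ _) (by
      have h1 := Submodule.finrank_quotient_add_finrank (hankelEntries (n + 1) d)
      have h2 := finrank_hankelEntries_le (n + 1) d
      rw [Module.finrank_fintype_fun_eq_card, Sym2.card, card_multiIndex, ← hN] at h1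
      rw [card_multiIndex] at h2
      rw [hcard]
      omega)
  obtain ⟨g₁, hg₁, hg₁0, h₁⟩ := exists_polyFun_linearIndependent hpoly hp₁
  obtain ⟨g₂, hg₂, hg₂0, h₂⟩ := exists_polyFun_linearIndependent
    (fun q : {q : Fin s × Fin s // q.1 < q.2} =>
      (hpoly q.1.1).bilin (hpoly q.1.2) (hankelPair (n + 1) d)) hp₂
  let g₀ : (Fin s → ℝ × (Fin n → ℝ)) → ℝ := ∏ i, fun p => (p i).1
  have hg₀ : g₀ ∈ polyFun (Fin s → ℝ × (Fin n → ℝ)) := Subalgebra.prod_mem _ fun i _ =>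
    linear_mem_polyFun (LinearMap.fst ℝ ℝ (Fin n → ℝ) ∘ₗ
      LinearMap.proj (φ := fun _ => ℝ × (Fin n → ℝ)) i)
  have hg₀0 : g₀ (fun _ => (1, 0)) ≠ 0 := by simp [g₀]
  refine holdsGenerically_of_ne_zero ((polyFun _).mul_mem hg₀ ((polyFun _).mul_mem hg₁ hg₂))
    (exists_mul_ne_zero hg₀ ((polyFun _).mul_mem hg₁ hg₂) ⟨_, hg₀0⟩
      (exists_mul_ne_zero hg₁ hg₂ ⟨_, hg₁0⟩ ⟨_, hg₂0⟩)) fun p hp => ?_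
  have hp' := right_ne_zero_of_mul hp
  refine ⟨fun i => ?_, h₁ p (left_ne_zero_of_mul hp'), h₂ p (right_ne_zero_of_mul hp')⟩
  have h0 : ∏ i, (p i).1 ≠ 0 := by
    have := left_ne_zero_of_mul hp
    simpa only [g₀, Finset.prod_apply] using this
  exact Finset.prod_ne_zero_iff.1 h0 i (Finset.mem_univ i)

end Hankel

/-! ### Simplicial faces, minimizers and step lengths -/

section Faces

open Matrix

variable {ι : Type*} {s : ℕ}

/-- The combination `∑ cᵢ vᵢ vᵢᵀ` of rank-one atoms. -/
def atomComb (v : Fin s → ι → ℝ) (c : Fin s → ℝ) : Matrix ι ι ℝ :=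
  ∑ i, c i • vecMulVec (v i) (v i)

/-- The cone of nonnegative combinations of the atoms in the support of `a`. -/
def atomFace (v : Fin s → ι → ℝ) (a : Fin s → ℝ) : Set (Matrix ι ι ℝ) :=
  {X | ∃ c : Fin s → ℝ, (∀ i, 0 ≤ c i) ∧ (∀ i, a i = 0 → c i = 0) ∧ X = atomComb v c}

theorem atomComb_add (v : Fin s → ι → ℝ) (c c' : Fin s → ℝ) :
    atomComb v (c + c') = atomComb v c + atomComb v c' := by
  simp [atomComb, add_smul, Finset.sum_add_distrib]

theorem atomComb_smul (v : Fin s → ι → ℝ) (r : ℝ) (c : Fin s → ℝ) :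
    atomComb v (r • c) = r • atomComb v c := by
  simp [atomComb, mul_smul, Finset.smul_sum]

theorem atomComb_single (v : Fin s → ι → ℝ) (i : Fin s) (r : ℝ) :
    atomComb v (Pi.single i r) = r • vecMulVec (v i) (v i) := by
  rw [atomComb, Finset.sum_eq_single i]
  · simp
  · intro j _ hj
    simp [hj]
  · simp

theorem convex_atomFace (v : Fin s → ι → ℝ) (a : Fin s → ℝ) : Convex ℝ (atomFace v a) := by
  rintro _ ⟨c, hc, hca, rfl⟩ _ ⟨c', hc', hca', rfl⟩ p q hp hq -
  refine ⟨p • c + q • c', fun i => ?_, fun i hi => ?_, ?_⟩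
  · exact add_nonneg (mul_nonneg hp (hc i)) (mul_nonneg hq (hc' i))
  · simp [hca i hi, hca' i hi]
  · rw [atomComb_add, atomComb_smul, atomComb_smul]

variable [Fintype ι]

/-- The atoms `vᵢ vᵢᵀ` span a simplicial face of the cone `C` of positive semidefinite matrices;
`u` is a dual system of `v`. -/
structure SpansSimplicialFace (C : Set (Matrix ι ι ℝ)) (v u : Fin s → ι → ℝ) : Prop where
  dual : ∀ i j, v i ⬝ᵥ u j = if i = j then 1 else 0
  posSemidef : ∀ X ∈ C, X.PosSemidef
  atomComb_mem : ∀ c : Fin s → ℝ, (∀ i, 0 ≤ c i) → atomComb v c ∈ C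
  offDiag_eq_zero : ∀ D : Fin s → Fin s → ℝ, (∀ i j, D i j = D j i) →
    (∑ i, ∑ j, D i j • vecMulVec (v i) (v j)) ∈ C → ∀ i j, i ≠ j → D i j = 0

theorem dotProduct_atomComb_mulVec (v : Fin s → ι → ℝ) (c : Fin s → ℝ) (y : ι → ℝ) :
    y ⬝ᵥ atomComb v c *ᵥ y = ∑ i, c i * (v i ⬝ᵥ y) ^ 2 := by
  simp only [atomComb, sum_mulVec, dotProduct_sum, smul_mulVec, vecMulVec_mulVec, dotProduct_smul,
    smul_eq_mul]
  refine Finset.sum_congr rfl fun i _ => ?_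
  rw [dotProduct_comm y (v i), MulOpposite.smul_eq_mul_unop, MulOpposite.unop_op]
  ring

variable {C : Set (Matrix ι ι ℝ)} {v u : Fin s → ι → ℝ}

theorem atomComb_injective (h : ∀ i j, v i ⬝ᵥ u j = if i = j then 1 else 0) :
    Function.Injective (atomComb v) := by
  have key : ∀ c : Fin s → ℝ, ∀ j, u j ⬝ᵥ atomComb v c *ᵥ u j = c j := fun c j => by
    rw [dotProduct_atomComb_mulVec]
    simp [h]
  intro c c' hcc
  ext j
  rw [← key c, ← key c', hcc]

/-- Each `y` differs from `∑ (v j ⬝ᵥ y) • u j` by a vector orthogonal to all `v i`, which `X` kills;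
so the bilinear form of `X` is determined by its values on the dual system. -/
theorem eq_sum_of_mulVec_eq_zero (h : ∀ i j, v i ⬝ᵥ u j = if i = j then 1 else 0)
    {X : Matrix ι ι ℝ} (hX : Xᵀ = X)
    (hker : ∀ y, (∀ i, v i ⬝ᵥ y = 0) → X *ᵥ y = 0) :
    X = ∑ i, ∑ j, (u i ⬝ᵥ X *ᵥ u j) • vecMulVec (v i) (v j) := by
  classical
  have hsymm : ∀ y w, y ⬝ᵥ X *ᵥ w = w ⬝ᵥ X *ᵥ y := fun y w => by
    rw [dotProduct_mulVec, ← mulVec_transpose, hX, dotProduct_comm]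
  have hexp : ∀ y, X *ᵥ y = ∑ j, (v j ⬝ᵥ y) • X *ᵥ u j := fun y => by
    have h0 := hker (y - ∑ j, (v j ⬝ᵥ y) • u j) fun i => by
      simp [dotProduct_sub, dotProduct_sum, dotProduct_smul, h]
    rw [mulVec_sub, sub_eq_zero] at h0
    rw [h0, mulVec_sum]
    simp only [mulVec_smul]
  have hbil : ∀ w y, w ⬝ᵥ X *ᵥ y = ∑ i, ∑ j, (u i ⬝ᵥ X *ᵥ u j) * ((v i ⬝ᵥ w) * (v j ⬝ᵥ y)) := by
    intro w y
    rw [hexp y, dotProduct_sum, Finset.sum_comm]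
    refine Finset.sum_congr rfl fun j _ => ?_
    rw [dotProduct_smul, hsymm w, hexp w, dotProduct_sum, smul_eq_mul, Finset.mul_sum]
    refine Finset.sum_congr rfl fun i _ => ?_
    rw [dotProduct_smul, hsymm (u j), smul_eq_mul]
    ring
  ext p q
  have := hbil (Pi.single p 1) (Pi.single q 1)
  simp only [mulVec_single_one, single_one_dotProduct, dotProduct_single_one, col_apply] at this
  rw [this]
  simp [Matrix.sum_apply, vecMulVec_apply]

theorem SpansSimplicialFace.mem_atomFace (h : SpansSimplicialFace C v u) {a : Fin s → ℝ}
    {X : Matrix ι ι ℝ} (hX : X ∈ C) (hker : ∀ y, (∀ i, a i ≠ 0 → v i ⬝ᵥ y = 0) → X *ᵥ y = 0) :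
    X ∈ atomFace v a := by
  have hpsd := h.posSemidef X hX
  have hsymm : Xᵀ = X := by simpa using hpsd.isHermitian.eq
  have hexp := eq_sum_of_mulVec_eq_zero h.dual hsymm fun y hy => hker y fun i _ => hy i
  have hoff := h.offDiag_eq_zero (fun i j => u i ⬝ᵥ X *ᵥ u j) (fun i j => by
    rw [dotProduct_mulVec, ← mulVec_transpose, hsymm, dotProduct_comm]) (hexp ▸ hX)
  refine ⟨fun i => u i ⬝ᵥ X *ᵥ u i, fun i => ?_, fun i hi => ?_, ?_⟩
  · simpa using hpsd.dotProduct_mulVec_nonneg (u i)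
  · have : X *ᵥ u i = 0 := hker _ fun j hj => by
      rw [h.dual, if_neg]
      rintro rfl
      exact hj hi
    simp only [this, dotProduct_zero]
  · conv_lhs => rw [hexp]
    refine Finset.sum_congr rfl fun i _ => Finset.sum_eq_single i (fun j _ hj => ?_) (by simp)
    rw [hoff i j hj.symm, zero_smul]

/-- If `y` is orthogonal to the supporting atoms, the quadratic form of `p X + q Y` vanishes at `y`.
Both summands are nonnegative, so `X *ᵥ y = 0`, and `mem_atomFace` applies. -/
theorem SpansSimplicialFace.isExtreme_atomFace (h : SpansSimplicialFace C v u) (a : Fin s → ℝ) :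
    IsExtreme ℝ C (atomFace v a) := by
  refine ⟨?_, ?_⟩
  · rintro _ ⟨c, hc, -, rfl⟩
    exact h.atomComb_mem c hc
  · rintro X hX Y hY _ ⟨c, hc, hca, rfl⟩ ⟨p, q, hp, hq, -, hXY⟩
    refine h.mem_atomFace hX fun y hy => ?_
    have h0 : y ⬝ᵥ atomComb v c *ᵥ y = 0 := by
      rw [dotProduct_atomComb_mulVec]
      refine Finset.sum_eq_zero fun i _ => ?_
      by_cases hi : a i = 0
      · rw [hca i hi, zero_mul]
      · rw [hy i hi]
        ring
    have hX0 := (h.posSemidef X hX).dotProduct_mulVec_nonneg y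
    have hY0 := (h.posSemidef Y hY).dotProduct_mulVec_nonneg y
    rw [star_trivial] at hX0 hY0
    rw [← hXY, add_mulVec, dotProduct_add, smul_mulVec, smul_mulVec, dotProduct_smul,
      dotProduct_smul, smul_eq_mul, smul_eq_mul] at h0
    have : y ⬝ᵥ X *ᵥ y = 0 := by
      have h1 := mul_nonneg hp.le hX0
      have h2 := mul_nonneg hq.le hY0
      exact (mul_eq_zero.1 (by linarith : p * (y ⬝ᵥ X *ᵥ y) = 0)).resolve_left hp.ne'
    exact ((h.posSemidef X hX).dotProduct_mulVec_zero_iff y).1 (by rwa [star_trivial])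

theorem SpansSimplicialFace.minface_eq (h : SpansSimplicialFace C v u) {a : Fin s → ℝ}
    (ha : ∀ i, 0 ≤ a i) : minface (atomComb v a) C = atomFace v a := by
  refine subset_antisymm (Set.sInter_subset_of_mem
    ⟨h.isExtreme_atomFace a, convex_atomFace v a, a, ha, fun _ hi => hi, rfl⟩) ?_
  rintro _ ⟨c, hc, hca, rfl⟩ F ⟨hF, -, haF⟩
  -- Such an `ε` exists because `c` is supported where `a` is positive.
  obtain ⟨ε, hε, hεc⟩ : ∃ ε : ℝ, 0 < ε ∧ ∀ i, ε * c i ≤ a i := by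
    have : ∀ᶠ ε : ℝ in nhdsWithin 0 (Set.Ioi 0), ∀ i, ε * c i ≤ a i := by
      refine eventually_all.2 fun i => ?_
      rcases (ha i).eq_or_lt with hi | hi
      · exact Eventually.of_forall fun ε => by rw [hca i hi.symm, mul_zero, ← hi]
      · have ht : Tendsto (fun ε : ℝ => ε * c i) (nhdsWithin 0 (Set.Ioi 0)) (nhds (0 * c i)) :=
          ((continuous_id.mul continuous_const).tendsto 0).mono_left nhdsWithin_le_nhds
        rw [zero_mul] at ht
        exact (ht.eventually (gt_mem_nhds hi)).mono fun _ => le_of_lt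
    obtain ⟨ε, h1, h2⟩ := (this.and self_mem_nhdsWithin).exists
    exact ⟨ε, h2, h1⟩
  have h1ε : 0 < 1 + ε := by linarith
  -- Prolong the segment from `c` through `a` slightly: `a` lies strictly between `c` and `a + ε (a
  -- - c)`, which is still nonnegative, so any face containing the matrix of `a` contains that of
  -- `c`.
  refine hF.left_mem_of_mem_openSegment (h.atomComb_mem c hc)
    (h.atomComb_mem (a + ε • (a - c)) fun i => ?_) haF
    ⟨ε / (1 + ε), 1 / (1 + ε), by positivity, by positivity, by field_simp; ring, ?_⟩
  · have h1 := mul_nonneg hε.le (ha i)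
    have h2 := hεc i
    simp only [Pi.add_apply, Pi.smul_apply, Pi.sub_apply, smul_eq_mul]
    linarith
  · rw [← atomComb_smul, ← atomComb_smul, ← atomComb_add]
    congr 1
    ext i
    simp only [Pi.add_apply, Pi.smul_apply, Pi.sub_apply, smul_eq_mul]
    field_simp
    ring

theorem trace_mul_atomComb (B : Matrix ι ι ℝ) (v : Fin s → ι → ℝ) (c : Fin s → ℝ) :
    (B * atomComb v c).trace = ∑ i, c i * (B * vecMulVec (v i) (v i)).trace := by
  simp [atomComb, Finset.mul_sum, trace_sum]

theorem trace_atomComb (v : Fin s → ι → ℝ) (c : Fin s → ℝ) :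
    (atomComb v c).trace = ∑ i, c i * (v i ⬝ᵥ v i) := by
  simp [atomComb, trace_sum, trace_vecMulVec]

/-- The value of the objective `⟨B, ·⟩` at the atom `v vᵀ` of trace one. -/
def atomValue (B : Matrix ι ι ℝ) (v : ι → ℝ) : ℝ :=
  (v ⬝ᵥ v)⁻¹ * (B * vecMulVec v v).trace

theorem argminSlice_atomFace (hv : ∀ i, 0 < v i ⬝ᵥ v i) {a : Fin s → ℝ} (ha : ∃ i, a i ≠ 0)
    {B : Matrix ι ι ℝ} (hB : Function.Injective fun i => atomValue B (v i)) :
    ∃ i, a i ≠ 0 ∧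
      argminSlice (atomFace v a) B = {(v i ⬝ᵥ v i)⁻¹ • vecMulVec (v i) (v i)} := by
  classical
  obtain ⟨i, hi, hmin⟩ := (Finset.univ.filter fun i => a i ≠ 0).exists_min_image
    (fun i => atomValue B (v i)) (by simpa [Finset.filter_nonempty_iff] using ha)
  simp only [Finset.mem_filter, Finset.mem_univ, true_and] at hi hmin
  refine ⟨i, hi, ?_⟩
  have hvn : ∀ j, v j ⬝ᵥ v j ≠ 0 := fun j => (hv j).ne'
  -- The numbers `c j * (v j ⬝ᵥ v j)` sum to one, so the objective exceeds the least vertex value by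
  -- a weighted sum of gaps. Injectivity makes every gap with `j ≠ i` nonzero, so a minimizer has no
  -- weight off `i`.
  have hval : ∀ c : Fin s → ℝ, (∑ j, c j * (v j ⬝ᵥ v j) = 1) → (B * atomComb v c).trace =
      atomValue B (v i) +
        ∑ j, c j * (v j ⬝ᵥ v j) * (atomValue B (v j) - atomValue B (v i)) := by
    intro c hc
    simp_rw [mul_sub, Finset.sum_sub_distrib, ← Finset.sum_mul, hc, one_mul, add_sub_cancel,
      trace_mul_atomComb]
    refine Finset.sum_congr rfl fun j _ => ?_
    rw [atomValue, mul_assoc, mul_inv_cancel_left₀ (hvn j)]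
  have hterm : ∀ c : Fin s → ℝ, (∀ j, 0 ≤ c j) → (∀ j, a j = 0 → c j = 0) → ∀ j,
      0 ≤ c j * (v j ⬝ᵥ v j) * (atomValue B (v j) - atomValue B (v i)) := by
    intro c hc hca j
    by_cases hj : a j = 0
    · simp [hca j hj]
    · exact mul_nonneg (mul_nonneg (hc j) (hv j).le) (sub_nonneg.2 (hmin j hj))
  have hMi : (v i ⬝ᵥ v i)⁻¹ • vecMulVec (v i) (v i) = atomComb v (Pi.single i (v i ⬝ᵥ v i)⁻¹) :=
    (atomComb_single v i _).symm
  have hMmem : (v i ⬝ᵥ v i)⁻¹ • vecMulVec (v i) (v i) ∈ atomFace v a := by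
    refine ⟨Pi.single i (v i ⬝ᵥ v i)⁻¹, fun j => ?_, fun j hj => ?_, hMi⟩
    · by_cases hj : j = i
      · subst hj
        simpa using (hv j).le
      · simp [hj]
    · have : j ≠ i := by
        rintro rfl
        exact hi hj
      simp [this]
  have hMtr : ((v i ⬝ᵥ v i)⁻¹ • vecMulVec (v i) (v i)).trace = 1 := by
    rw [trace_smul, trace_vecMulVec, smul_eq_mul, inv_mul_cancel₀ (hvn i)]
  have hMval : (B * ((v i ⬝ᵥ v i)⁻¹ • vecMulVec (v i) (v i))).trace = atomValue B (v i) := by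
    rw [Matrix.mul_smul, trace_smul, smul_eq_mul, atomValue]
  ext M
  simp only [Set.mem_singleton_iff]
  constructor
  · rintro ⟨⟨⟨c, hc, hca, rfl⟩, htr⟩, hM⟩
    rw [trace_atomComb] at htr
    have h1 := hM _ hMmem hMtr
    rw [hMval, hval c htr] at h1
    have h2 := (Finset.sum_eq_zero_iff_of_nonneg fun j _ => hterm c hc hca j).1
      (le_antisymm (by linarith) (Finset.sum_nonneg fun j _ => hterm c hc hca j))
    have h3 : ∀ j, j ≠ i → c j = 0 := fun j hj => by
      have h4 := h2 j (Finset.mem_univ j)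
      rw [mul_eq_zero, mul_eq_zero, sub_eq_zero] at h4
      rcases h4 with (h4 | h4) | h4
      · exact h4
      · exact absurd h4 (hvn j)
      · exact absurd (hB h4) hj
    rw [Finset.sum_eq_single i (fun j _ hj => by rw [h3 j hj, zero_mul]) (by simp)] at htr
    rw [hMi]
    congr 1
    ext j
    by_cases hj : j = i
    · subst hj
      rw [Pi.single_eq_same]
      exact eq_inv_of_mul_eq_one_left htr
    · rw [Pi.single_eq_of_ne hj, h3 j hj]
  · rintro rfl
    refine ⟨⟨hMmem, hMtr⟩, ?_⟩
    rintro _ ⟨c, hc, hca, rfl⟩ htr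
    rw [trace_atomComb] at htr
    rw [hMval, hval c htr]
    exact le_add_of_nonneg_right (Finset.sum_nonneg fun j _ => hterm c hc hca j)

theorem isStepLength_atomFace_iff (hdual : ∀ i j, v i ⬝ᵥ u j = if i = j then 1 else 0)
    (hv : ∀ i, 0 < v i ⬝ᵥ v i) {a : Fin s → ℝ} (ha : ∀ i, 0 ≤ a i) {i : Fin s} (hi : a i ≠ 0)
    (t : ℝ) :
    IsStepLength (atomFace v a) (atomComb v a) ((v i ⬝ᵥ v i)⁻¹ • vecMulVec (v i) (v i)) t ↔
      t = a i * (v i ⬝ᵥ v i) := by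
  -- Only the `i`-th coefficient moves. Coefficients are unique by the dual system, so feasibility
  -- ends exactly when it reaches zero.
  have hset : {t : ℝ | 0 ≤ t ∧ atomComb v a - t • (v i ⬝ᵥ v i)⁻¹ • vecMulVec (v i) (v i) ∈
      atomFace v a} = Set.Icc 0 (a i * (v i ⬝ᵥ v i)) := by
    ext t
    have heq : atomComb v a - t • (v i ⬝ᵥ v i)⁻¹ • vecMulVec (v i) (v i) =
        atomComb v (a + (-t * (v i ⬝ᵥ v i)⁻¹) • Pi.single i 1) := by
      rw [atomComb_add, atomComb_smul, atomComb_single, one_smul, smul_smul, neg_mul, neg_smul,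
        sub_eq_add_neg]
    have hle : t ≤ a i * (v i ⬝ᵥ v i) ↔ 0 ≤ a i + -t * (v i ⬝ᵥ v i)⁻¹ := by
      rw [neg_mul, ← sub_eq_add_neg, sub_nonneg, ← div_eq_mul_inv, div_le_iff₀ (hv i)]
    simp only [Set.mem_ofPred_eq, Set.mem_Icc, heq]
    refine and_congr_right fun _ => ?_
    rw [hle]
    constructor
    · rintro ⟨c, hc, -, hac⟩
      have := congrFun (atomComb_injective hdual hac) i
      simp only [Pi.add_apply, Pi.smul_apply, Pi.single_eq_same, smul_eq_mul, mul_one] at this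
      rw [this]
      exact hc i
    · intro h0
      refine ⟨_, fun j => ?_, fun j hj => ?_, rfl⟩
      · by_cases hj : j = i
        · subst hj
          simpa using h0
        · simpa [hj] using ha j
      · have : j ≠ i := by
          rintro rfl
          exact hi hj
        simp [this, hj]
  have hlub : IsLUB (Set.Icc 0 (a i * (v i ⬝ᵥ v i))) (a i * (v i ⬝ᵥ v i)) :=
    isLUB_Icc (mul_nonneg (ha i) (hv i).le)
  rw [IsStepLength, hset]
  exact ⟨fun h => h.unique hlub, fun h => h ▸ hlub⟩

end Faces

/-! ### Executions of the algorithm -/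

section Run

open Matrix

variable {ι : Type*} {s : ℕ} {v u : Fin s → ι → ℝ}

/-- The weights that are left after the atoms in the range of `σ` have been removed. -/
def remaining (a : Fin s → ℝ) {r : ℕ} (σ : Fin r → Fin s) : Fin s → ℝ :=
  open Classical in fun i => if i ∈ Set.range σ then 0 else a i

theorem remaining_nonneg {a : Fin s → ℝ} (ha : ∀ i, 0 < a i) {r : ℕ} (σ : Fin r → Fin s)
    (i : Fin s) : 0 ≤ remaining a σ i := by
  unfold remaining
  split_ifs
  exacts [le_rfl, (ha i).le]

theorem remaining_ne_zero_iff {a : Fin s → ℝ} (ha : ∀ i, 0 < a i) {r : ℕ} (σ : Fin r → Fin s)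
    (i : Fin s) : remaining a σ i ≠ 0 ↔ i ∉ Set.range σ := by
  unfold remaining
  split_ifs with h
  · simpa using h
  · simpa [(ha i).ne'] using h

theorem exists_remaining_ne_zero {a : Fin s → ℝ} {r : ℕ} {σ : Fin r → Fin s}
    (h : atomComb v (remaining a σ) ≠ 0) : ∃ i, remaining a σ i ≠ 0 := by
  by_contra! h0
  exact h (by simp [atomComb, h0])

variable [Fintype ι] {C : Set (Matrix ι ι ℝ)}

theorem IsRun.of_succ {B : ℕ → Matrix ι ι ℝ} {X₀ : Matrix ι ι ℝ} {r : ℕ} {X : ℕ → Matrix ι ι ℝ}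
    {t : ℕ → ℝ} {M : ℕ → Matrix ι ι ℝ} (h : IsRun C B X₀ (r + 1) X t M) :
    IsRun C B X₀ r X t M :=
  ⟨h.start, fun k hk => h.loop k (hk.trans r.lt_succ_self),
    fun k hk => h.argmin k (hk.trans r.lt_succ_self),
    fun k hk => h.length k (hk.trans r.lt_succ_self),
    fun k hk => h.update k (hk.trans r.lt_succ_self)⟩

/-- Every run peels off distinct atoms, with their full weight. -/
theorem SpansSimplicialFace.exists_injective_of_isRun (h : SpansSimplicialFace C v u)
    (hv : ∀ i, 0 < v i ⬝ᵥ v i) {a : Fin s → ℝ} (ha : ∀ i, 0 < a i) {B : ℕ → Matrix ι ι ℝ}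
    (hB : ∀ k, Function.Injective fun i => atomValue (B k) (v i)) {r : ℕ}
    {X : ℕ → Matrix ι ι ℝ} {t : ℕ → ℝ} {M : ℕ → Matrix ι ι ℝ}
    (hrun : IsRun C B (atomComb v a) r X t M) :
    ∃ σ : Fin r → Fin s, Function.Injective σ ∧ X r = atomComb v (remaining a σ) ∧
      ∀ k : Fin r, t k = a (σ k) * (v (σ k) ⬝ᵥ v (σ k)) ∧
        M k = (v (σ k) ⬝ᵥ v (σ k))⁻¹ • vecMulVec (v (σ k)) (v (σ k)) := by
  induction r with
  | zero =>
    refine ⟨Fin.elim0, fun i => i.elim0, ?_, fun k => k.elim0⟩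
    rw [hrun.start]
    congr 1
  | succ r ih =>
    obtain ⟨σ, hσ, hX, hout⟩ := ih hrun.of_succ
    have hr := r.lt_succ_self
    have hne := hrun.loop r hr
    have harg := hrun.argmin r hr
    have hlen := hrun.length r hr
    have hupd := hrun.update r hr
    rw [hX] at hne
    rw [hX, h.minface_eq (remaining_nonneg ha σ)] at harg hlen
    obtain ⟨i, hi, hset⟩ := argminSlice_atomFace hv (exists_remaining_ne_zero hne) (hB r)
    rw [hset, Set.mem_singleton_iff] at harg
    rw [harg, isStepLength_atomFace_iff h.dual hv (remaining_nonneg ha σ) hi] at hlen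
    have hiσ := (remaining_ne_zero_iff ha σ i).1 hi
    have hai : remaining a σ i = a i := if_neg hiσ
    rw [hai] at hlen
    refine ⟨Fin.snoc σ i, Fin.snoc_injective_iff.2 ⟨hσ, hiσ⟩, ?_, fun k => ?_⟩
    · rw [hupd, hX, hlen, harg, smul_smul, mul_assoc, mul_inv_cancel₀ (hv i).ne', mul_one,
        sub_eq_iff_eq_add, ← atomComb_single, ← atomComb_add]
      congr 1
      ext j
      rw [Pi.add_apply]
      simp only [remaining, Fin.range_snoc, Set.mem_insert_iff]
      by_cases hj : j = i
      · subst hj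
        simp [hiσ]
      · simp [hj]
    · induction k using Fin.lastCases with
      | last => simpa using ⟨hlen, harg⟩
      | cast k => simpa using hout k

/-- All clauses follow from the injection `σ` of passes into atoms: `s + 1` passes are impossible,
and a zero iterate leaves no weight, so `σ` is then onto. -/
theorem SpansSimplicialFace.alwaysReturns (h : SpansSimplicialFace C v u)
    (hv : ∀ i, 0 < v i ⬝ᵥ v i) {a : Fin s → ℝ} (ha : ∀ i, 0 < a i) {B : ℕ → Matrix ι ι ℝ}
    (hB : ∀ k, Function.Injective fun i => atomValue (B k) (v i)) :
    AlwaysReturns C B (atomComb v a) fun r t M =>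
      r = s ∧ ∃ σ : Fin r ≃ Fin s, ∀ k : Fin r,
        t k = a (σ k) * (v (σ k) ⬝ᵥ v (σ k)) ∧
        M k = (v (σ k) ⬝ᵥ v (σ k))⁻¹ • vecMulVec (v (σ k)) (v (σ k)) where
  argmin_nonempty r X t M hrun hne := by
    obtain ⟨σ, -, hX, -⟩ := h.exists_injective_of_isRun hv ha hB hrun
    rw [hX] at hne
    obtain ⟨i, -, hset⟩ := argminSlice_atomFace hv (exists_remaining_ne_zero hne) (hB r)
    rw [hX, h.minface_eq (remaining_nonneg ha σ), hset]
    exact Set.singleton_nonempty _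
  length_exists r X t M hrun hne N hN := by
    obtain ⟨σ, -, hX, -⟩ := h.exists_injective_of_isRun hv ha hB hrun
    rw [hX] at hne
    obtain ⟨i, hi, hset⟩ := argminSlice_atomFace hv (exists_remaining_ne_zero hne) (hB r)
    rw [hX, h.minface_eq (remaining_nonneg ha σ), hset, Set.mem_singleton_iff] at hN
    rw [hX, h.minface_eq (remaining_nonneg ha σ), hN]
    exact ⟨_, (isStepLength_atomFace_iff h.dual hv (remaining_nonneg ha σ) hi _).2 rfl⟩
  terminates := by
    rintro ⟨X, t, M, hrun⟩
    obtain ⟨σ, hσ, -⟩ := h.exists_injective_of_isRun hv ha hB (hrun (s + 1))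
    simpa using Fintype.card_le_of_injective σ hσ
  output r X t M hrun h0 := by
    obtain ⟨σ, hσ, hX, hout⟩ := h.exists_injective_of_isRun hv ha hB hrun
    have hzero : remaining a σ = 0 := atomComb_injective h.dual (by
      rw [← hX, h0]
      simp [atomComb])
    have hsurj : Function.Surjective σ := fun i => by
      by_contra hi
      exact (remaining_ne_zero_iff ha σ i).2 hi (congrFun hzero i)
    refine ⟨by simpa using Fintype.card_of_bijective ⟨hσ, hsurj⟩,
      Equiv.ofBijective σ ⟨hσ, hsurj⟩, hout⟩

end Run

/-! ### Growth of the bound -/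

section Growth

theorem tendsto_add_choose_div_pow (a k : ℕ) :
    Tendsto (fun n : ℕ => ((n + a).choose k : ℝ) / (n : ℝ) ^ k) atTop
      (nhds ((k.factorial : ℝ)⁻¹)) := by
  have h1 : Tendsto (fun n : ℕ => (n.choose k : ℝ) / ((n : ℝ) ^ k / k.factorial)) atTop
      (nhds 1) := by
    refine (isEquivalent_iff_tendsto_one ?_).1 (isEquivalent_choose k)
    filter_upwards [eventually_gt_atTop 0] with n hn
    positivity
  have h2 := h1.comp (tendsto_add_atTop_nat a)
  have h3 : Tendsto (fun n : ℕ => 1 + (a : ℝ) * (n : ℝ)⁻¹) atTop (nhds (1 + (a : ℝ) * 0)) :=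
    tendsto_const_nhds.add (tendsto_const_nhds.mul tendsto_inv_atTop_nhds_zero_nat)
  have h4 := (h2.mul (h3.pow k)).mul_const ((k.factorial : ℝ)⁻¹)
  simp only [mul_zero, add_zero, one_pow, one_mul] at h4
  refine h4.congr' ?_
  filter_upwards [eventually_gt_atTop 0] with n hn
  have hn' : (n : ℝ) ≠ 0 := by positivity
  have hna : (n : ℝ) + a ≠ 0 := by positivity
  have hk : (k.factorial : ℝ) ≠ 0 := by positivity
  have h5 : 1 + (a : ℝ) * (n : ℝ)⁻¹ = (n + a) / n := by field_simp
  rw [h5, div_pow]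
  simp only [Function.comp_apply, Nat.cast_add]
  field_simp

/-- Equivalent to a central binomial coefficient exceeding `2`. For `d = 1` equality holds, and the
leading coefficient of the bound would vanish. -/
theorem two_mul_factorial_sq_lt {d : ℕ} (hd : 2 ≤ d) :
    2 * (d.factorial * d.factorial) < (2 * d).factorial := by
  have h1 : (2 * d).choose 1 ≤ d.centralBinom := Nat.choose_le_centralBinom 1 d
  rw [Nat.choose_one_right] at h1
  have h2 := Nat.choose_mul_factorial_mul_factorial (show d ≤ 2 * d by omega)
  rw [← Nat.centralBinom_eq_two_mul_choose, show 2 * d - d = d by omega, mul_assoc] at h2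
  rw [← h2]
  exact Nat.mul_lt_mul_of_pos_right (by omega) (by positivity)

theorem atomBound_isTheta {d : ℕ} (hd : 2 ≤ d) :
    (fun n : ℕ => atomBound n d) =Θ[atTop] (fun n : ℕ => (n : ℝ) ^ d) := by
  have hA := tendsto_add_choose_div_pow d d
  have hD := tendsto_add_choose_div_pow (2 * d) (2 * d)
  have h0 : Tendsto (fun n : ℕ => ((n : ℝ)⁻¹) ^ d) atTop (nhds (0 ^ d)) :=
    tendsto_inv_atTop_nhds_zero_nat.pow d
  rw [zero_pow (by omega)] at h0
  have hd0 : (d.factorial : ℝ) ≠ 0 := by positivity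
  -- The bound divided by `n ^ d` tends to `1 / (2 d!) - d! / (2d)!`.
  have hlim := ((hA.add h0).const_mul (1 / 2)).sub ((hA.inv₀ (inv_ne_zero hd0)).mul hD)
  refine (isTheta_of_div_tendsto_nhds_ne_zero (hlim.congr' ?_) ?_).symm
  · filter_upwards [eventually_gt_atTop 0] with n hn
    have hn' : (n : ℝ) ≠ 0 := by positivity
    have hN : ((n + d).choose d : ℝ) ≠ 0 := by
      exact_mod_cast (Nat.choose_pos (by omega : d ≤ n + d)).ne'
    rw [atomBound, pow_mul', sq]
    simp only [inv_pow]
    field_simp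
  · have h1 : (2 * (d.factorial * d.factorial) : ℝ) < (2 * d).factorial := by
      exact_mod_cast two_mul_factorial_sq_lt hd
    have h2 : (0 : ℝ) < d.factorial := by positivity
    have h3 : (0 : ℝ) < (2 * d).factorial := by positivity
    have h4 : ((d.factorial : ℝ)⁻¹)⁻¹ * ((2 * d).factorial : ℝ)⁻¹ <
        1 / 2 * ((d.factorial : ℝ)⁻¹ + 0) := by
      rw [inv_inv, add_zero, ← div_eq_mul_inv, div_lt_iff₀ h3]
      field_simp
      linarith
    exact (sub_pos.2 h4).ne'

end Growth

/-! ### Absence of ties almost surely -/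

section AlmostSure

open Matrix

variable {ι : Type*} [Fintype ι] {s : ℕ}

theorem exists_dual_system {v : Fin s → ι → ℝ} (hv : LinearIndependent ℝ v) :
    ∃ u : Fin s → ι → ℝ, ∀ i j, v i ⬝ᵥ u j = if i = j then 1 else 0 := by
  classical
  obtain ⟨L, hL⟩ := (Finsupp.linearCombination ℝ v).exists_leftInverse_of_injective
    (LinearMap.ker_eq_bot.2 hv)
  refine ⟨fun j α => L (Pi.single α 1) j, fun i j => ?_⟩
  have h1 : L (v i) = Finsupp.single i 1 := by
    simpa using LinearMap.congr_fun hL (Finsupp.single i 1)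
  have h2 : L (v i) j = v i ⬝ᵥ fun α => L (Pi.single α 1) j := by
    conv_lhs => rw [pi_eq_sum_univ' (v i)]
    simp [dotProduct, Finsupp.finsetSum_apply]
  rw [← h2, h1, Finsupp.single_apply]

/-- `atomValue` as a linear functional of the entries of the symmetric matrix. -/
def atomValueₗ (v : ι → ℝ) : (Sym2 ι → ℝ) →ₗ[ℝ] ℝ where
  toFun b := atomValue (symOfEntries b) v
  map_add' b c := by
    have : symOfEntries (b + c) = symOfEntries b + symOfEntries c := rfl
    rw [this, atomValue, add_mul, trace_add, mul_add]
    rfl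
  map_smul' r b := by
    have : symOfEntries (r • b) = r • symOfEntries b := rfl
    rw [this, atomValue, smul_mul, trace_smul, smul_eq_mul, mul_left_comm]
    rfl

theorem atomValue_vecMulVec (u v : ι → ℝ) :
    atomValue (vecMulVec u u) v = (v ⬝ᵥ v)⁻¹ * (v ⬝ᵥ u) ^ 2 := by
  rw [atomValue, vecMulVec_mul_vecMulVec, trace_vecMulVec, dotProduct_smul, dotProduct_comm u v,
    smul_eq_mul, sq]

theorem ae_injective_atomValue [DecidableEq ι] {v u : Fin s → ι → ℝ}
    (hdual : ∀ i j, v i ⬝ᵥ u j = if i = j then 1 else 0) (hv : ∀ i, 0 < v i ⬝ᵥ v i)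
    {Ω : Type*} [MeasurableSpace Ω] {P : Measure Ω} {B : Ω → Matrix ι ι ℝ}
    (hB : IsACRandomSym P B) :
    ∀ᵐ ω ∂P, Function.Injective fun i => atomValue (B ω) (v i) := by
  obtain ⟨b, hb, hac, hBb⟩ := hB
  have key : ∀ i j, i ≠ j → ∀ᵐ ω ∂P, atomValue (B ω) (v i) ≠ atomValue (B ω) (v j) := by
    intro i j hij
    set K := LinearMap.ker (atomValueₗ (v i) - atomValueₗ (v j)) with hK
    have hKtop : K ≠ ⊤ := by
      intro htop
      -- The matrix `u i (u i)ᵀ` separates the two atoms: its value is positive at `v i` and zero at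
      -- `v j`. So ties lie in a proper subspace.
      have hmem : (fun e => e.lift ⟨fun k l => u i k * u i l, fun k l => mul_comm _ _⟩ :
          Sym2 ι → ℝ) ∈ K := htop ▸ Submodule.mem_top
      rw [hK, LinearMap.mem_ker, LinearMap.sub_apply] at hmem
      change atomValue (vecMulVec (u i) (u i)) (v i) -
        atomValue (vecMulVec (u i) (u i)) (v j) = 0 at hmem
      rw [atomValue_vecMulVec, atomValue_vecMulVec, hdual, hdual, if_pos rfl, if_neg hij.symm] at hmem
      have := inv_pos.2 (hv i)
      simp at hmem
      exact (hv i).ne' (by simp [hmem])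
    have hnull : ∀ᵐ x ∂(Measure.map b P), x ∉ (K : Set (Sym2 ι → ℝ)) :=
      measure_eq_zero_iff_ae_notMem.1 (hac (Measure.addHaar_submodule volume K hKtop))
    filter_upwards [ae_of_ae_map hb.aemeasurable hnull] with ω hω heq
    refine hω ?_
    rw [hBb ω] at heq
    exact LinearMap.mem_ker.2 (sub_eq_zero.2 heq)
  have hall : ∀ᵐ ω ∂P, ∀ i j, i ≠ j → atomValue (B ω) (v i) ≠ atomValue (B ω) (v j) := by
    simp only [ae_all_iff]
    exact key
  filter_upwards [hall] with ω hω i j hij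
  by_contra hne
  exact hω i j hne hij

end AlmostSure

/-! ### Application to the pseudo-moment cone -/

theorem spansSimplicialFace_pseudoMomentCone {n d s : ℕ} {z : Fin s → Fin n → ℝ}
    (hz : PairIndependent (hankelPair (n + 1) d) fun i => momentVec d (z i))
    {u : Fin s → MultiIndex (n + 1) d → ℝ}
    (hu : ∀ i j, momentVec d (z i) ⬝ᵥ u j = if i = j then 1 else 0) :
    SpansSimplicialFace (pseudoMomentCone (n + 1) d) (fun i => momentVec d (z i)) u where
  dual := hu
  posSemidef X hX := ((mem_pseudoMomentCone_iff X).1 hX).2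
  atomComb_mem c hc := by
    refine (mem_pseudoMomentCone_iff _).2 ⟨?_, ?_⟩
    · exact (hankelSubmodule (n + 1) d).sum_mem fun i _ =>
        (hankelSubmodule (n + 1) d).smul_mem _ (isHankel_momentAtom (z i))
    · refine Matrix.posSemidef_sum _ fun i _ => Matrix.PosSemidef.smul ?_ (hc i)
      simpa using Matrix.posSemidef_vecMulVec_self_star (momentVec d (z i))
  offDiag_eq_zero D hD hX i j hij :=
    eq_zero_of_isHankel hz (fun i => isHankel_momentAtom (z i)) hD
      ((mem_pseudoMomentCone_iff _).1 hX).1 hij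

theorem momentNormSq_eq {n : ℕ} (d : ℕ) (z : Fin n → ℝ) :
    momentNormSq d z = momentVec d z ⬝ᵥ momentVec d z := by
  rw [momentNormSq, EuclideanSpace.real_norm_sq_eq, dotProduct]
  exact Finset.sum_congr rfl fun i _ => sq _

end PseudoMoment

end

theorem theorem3 (d : ℕ) (hd : 2 ≤ d) :
    (fun n : ℕ => atomBound n d) =Θ[atTop] (fun n : ℕ => (n : ℝ) ^ d) ∧
    ∀ n : ℕ, 1 ≤ n → ∀ s : ℕ, 1 ≤ s → (s : ℝ) ≤ atomBound n d →
      HoldsGenerically fun p : Fin s → ℝ × (Fin n → ℝ) =>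
        ∀ (Ω : Type*) [MeasurableSpace Ω] (P : Measure Ω) [IsProbabilityMeasure P]
          (B : ℕ → Ω → MomMat (n + 1) d), (∀ k, IsACRandomSym P (B k)) →
          ∀ᵐ ω ∂P, AlwaysReturns (pseudoMomentCone (n + 1) d) (fun k => B k ω)
            (atomicMatrix d p) fun r t M =>
              r = s ∧ ∃ σ : Fin r ≃ Fin s, ∀ k : Fin r,
                t k = (p (σ k)).1 ^ 2 * momentNormSq d (p (σ k)).2 ∧
                M k = (momentNormSq d (p (σ k)).2)⁻¹ • momentAtom d (p (σ k)).2 := by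
  refine ⟨atomBound_isTheta hd, fun n _ s _ hs => ?_⟩
  obtain ⟨U, hU, hUd, hUP⟩ := holdsGenerically_momentVec hs
  refine ⟨U, hU, hUd, fun p hp Ω _ P _ B hB => ?_⟩
  obtain ⟨hw, hlin, hpair⟩ := hUP p hp
  obtain ⟨u, hu⟩ := exists_dual_system hlin
  have hface := spansSimplicialFace_pseudoMomentCone hpair hu
  have hv : ∀ i, 0 < momentVec d (p i).2 ⬝ᵥ momentVec d (p i).2 := fun i => by
    simpa using Matrix.dotProduct_star_self_pos_iff.2 (momentVec_ne_zero d (p i).2)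
  -- A countable union of null events, one for each pass; only the marginal laws of the `B k` enter.
  filter_upwards [ae_all_iff.2 fun k => ae_injective_atomValue hu hv (hB k)] with ω hω
  simp only [momentNormSq_eq]
  exact hface.alwaysReturns hv (a := fun i => (p i).1 ^ 2) (fun i => by have := hw i; positivity) hω
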